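/- Let $p>2$ be a prime, let $k$ be a perfect field of characteristic $p$, and let $d$ be a positive integer not divisible by $p$. Let $A\subseteq\mathbb{A}^{d+1}_k$ be the open subset of tuples $a=(a_0,\dots,a_d)$ with $a_d\neq0$. For a perfect extension field $K$ of $k$ and $a\in A(K)$ let $f_a(x)=a_0+a_1x+\cdots+a_dx^d$, let $Y_a$ be the Artin–Schreier curve $y^p-y=f_a(x)$ over $K$, with function field $K(Y_a)=K(x)[y]/(y^p-y-f_a(x))$, and let $\mathcal C$ be the Cartier operator on its differentials: $\mathcal C(\omega)=g_{p-1}\,dx$ if $\omega=(g_0^p+g_1^px+\cdots+g_{p-1}^px^{p-1})\,dx$ with $g_n\in K(Y_a)$. For $i,j\ge1$ put $\omega_{i,j}=y^{j-1}x^{i-1}\,dx$. For $0<J<p$ let $${}'H^J=\Big\langle \omega_{i,J}\ \Big|\ 0<i<\tfrac{(p-J)d}{p},\ p\nmid i\Big\rangle,$$ and for $0<\ell\le e<p$ let $$H(\ell,e)=\Big\langle \omega_{i,\ell}\ \Big|\ 0<i\le\Big\lfloor\tfrac{(p(e+1-\ell)-e)d}{p^2}\Big\rfloor\Big\rangle$$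 (spans over $K$). There is a non-empty Zariski open subset $U\subseteq A$ such that for every perfect extension field $K$ of $k$ (for example $K=k$) and every $a\in U(K)$ the following hold. For $1<J<p$, the operator $\mathcal C$ maps ${}'H^J$ into the (internal) direct sum $\bigoplus_{\ell=1}^{J-1}H(\ell,J)$, so that the composition $$\Phi_J:\ {}'H^J\xrightarrow{\ \mathcal C\ }\bigoplus_{\ell=1}^{J-1}H(\ell,J)\longrightarrow\bigoplus_{\ell=1}^{J-1}\frac{H(\ell,J)}{H(\ell,J-1)}$$ of $\mathcal C$ with the natural projection is defined; moreover 1. if $1<J\le(p+1)/2$, then $\Phi_J$ is surjective; 2. if $(p+1)/2\le J<p$, then $\Phi_J$ is injective. -/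

import Mathlib

open Polynomial
open scoped KaehlerDifferential

universe u

namespace ArtinSchreier

noncomputable section

/-- The point of affine space `Spec k[a₀,…,a_d]` underlying a `K`-rational point `a`, for a field
extension `K / k`: the kernel of the evaluation `k[a₀,…,a_d] → K` at `a`.  For an open subset `U` of
affine space, `a ∈ U(K)` means that this point belongs to `U`. -/
def ratPoint (k : Type u) {K : Type u} [Field k] [Field K] [Algebra k K] {d : ℕ}
    (a : Fin (d + 1) → K) : PrimeSpectrum (MvPolynomial (Fin (d + 1)) k) :=
  ⟨RingHom.ker (MvPolynomial.aeval (R := k) a), RingHom.ker_isPrime _⟩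

/-- The parameter space: the open subset `a_d ≠ 0` of `Spec k[a₀,…,a_d]`. -/
def paramSpace (k : Type u) [Field k] (d : ℕ) :
    Set (PrimeSpectrum (MvPolynomial (Fin (d + 1)) k)) :=
  (PrimeSpectrum.basicOpen (MvPolynomial.X (Fin.last d) : MvPolynomial (Fin (d + 1)) k) : Set _)

variable {K : Type u} [Field K] (p : ℕ) {d : ℕ} (a : Fin (d + 1) → K)

/-- `f_a(x) = a₀ + a₁ x + ⋯ + a_d x^d`. -/
def fPoly : K[X] := ∑ i : Fin (d + 1), C (a i) * X ^ (i : ℕ)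

/-- The function field `K(Y_a) = K(x)[y] / (y^p - y - f_a(x))` of the Artin–Schreier curve
`Y_a : y^p - y = f_a(x)`. -/
abbrev FunField : Type u :=
  AdjoinRoot (X ^ p - X - C (algebraMap K[X] (RatFunc K) (fPoly a)) : (RatFunc K)[X])

/-- The function `x` on `Y_a`. -/
def xFun : FunField p a := AdjoinRoot.of _ RatFunc.X

/-- The function `y` on `Y_a`. -/
def yFun : FunField p a := AdjoinRoot.root _

/-- The rational differentials on `Y_a`, i.e. the Kähler differentials of `K(Y_a)` over `K`. -/
abbrev Diff : Type u := Ω[FunField p a⁄K]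

/-- The differential `dx`. -/
def dx : Diff p a := KaehlerDifferential.D K (FunField p a) (xFun p a)

open Classical in
/-- The Cartier operator: if `ω = (g₀^p + g₁^p x + ⋯ + g_{p-1}^p x^{p-1}) dx`, then
`𝒞(ω) = g_{p-1} dx`.  Every `ω` has exactly one such expression, because `1, x, …, x^{p-1}` is a
basis of `K(Y)` over `K(Y)^p` and `dx` is a basis of the differentials over `K(Y)`; so the `else`
branch is never reached for the curves considered. -/
def cartier (ω : Diff p a) : Diff p a :=
  if h : ∃ g : ℕ → FunField p a,
      ω = (∑ n ∈ Finset.range p, g n ^ p * xFun p a ^ n) • dx p a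
  then h.choose (p - 1) • dx p a
  else 0

/-- `ω_{i,j} = y^{j-1} x^{i-1} dx` (used for `i, j ≥ 1` only). -/
def omega (i j : ℕ) : Diff p a :=
  (yFun p a ^ (j - 1) * xFun p a ^ (i - 1)) • dx p a

/-- `′H^J`: the `K`-span of the `ω_{i,J}` with `0 < i < (p - J) d / p` and `p ∤ i`. -/
def HPrime (J : ℕ) : Submodule K (Diff p a) :=
  Submodule.span K {ω | ∃ i : ℕ, 0 < i ∧ (i : ℚ) < ((p : ℚ) - J) * d / p ∧ ¬ p ∣ i ∧
    ω = omega p a i J}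

/-- `H(ℓ,e)`: the `K`-span of the `ω_{i,ℓ}` with `0 < i ≤ ⌊(p (e + 1 - ℓ) - e) d / p²⌋` if
`ℓ ≤ e`, and zero if `e < ℓ`. -/
def HLevel (l e : ℕ) : Submodule K (Diff p a) :=
  Submodule.span K {ω | l ≤ e ∧ ∃ i : ℕ, 0 < i ∧
    (i : ℤ) ≤ ⌊((p : ℚ) * (e + 1 - l) - e) * d / (p : ℚ) ^ 2⌋ ∧ ω = omega p a i l}

/-- The target `⨁_{ℓ=1}^{J-1} H(ℓ,J) / H(ℓ,J-1)` of `Φ_J`; the sum is finite, so it is written as a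
product. -/
abbrev PhiTarget (J : ℕ) : Type u :=
  (l : Finset.Ico 1 J) →
    HLevel p a l J ⧸ (HLevel p a l (J - 1)).submoduleOf (HLevel p a l J)

open Classical in
/-- The components of `𝒞(ω)` in `⨁_{ℓ=1}^{J-1} H(ℓ,J)`. -/
def cartierComponents (J : ℕ) (ω : Diff p a) : (l : Finset.Ico 1 J) → HLevel p a l J :=
  if h : ∃ η : (l : Finset.Ico 1 J) → HLevel p a l J, ∑ l, (η l : Diff p a) = cartier p a ω
  then h.choose
  else 0

/-- `Φ_J : ′H^J → ⨁_{ℓ=1}^{J-1} H(ℓ,J) → ⨁_{ℓ=1}^{J-1} H(ℓ,J) / H(ℓ,J-1)`: the Cartier operator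
followed by the natural projection. -/
def Phi (J : ℕ) (ω : HPrime p a J) : PhiTarget p a J :=
  fun l => Submodule.Quotient.mk (cartierComponents p a J (ω : Diff p a) l)

end

end ArtinSchreier

namespace ArtinSchreier

/-! ### Bases of the function field over `K(x)` and over its `p`-th powers. -/

section FunctionField

variable {K : Type u} [Field K] {p : ℕ} {d : ℕ} {a : Fin (d + 1) → K}

/-! Substitute `y = y^p - f` in `y^{J-1} P(x) dx` and expand. Powers of `y^p` pass through `𝒞`, so
with `n = J - ℓ` the component of `𝒞(ω)` at `y^{ℓ-1} dx` is governed by the coefficients of `f^n P`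
at `x^{pm+p-1}` (`cartier_polyDiff`). Nonzero binomial factors and the bijective `p`-th root affect
neither injectivity nor surjectivity. Thus `Φ_J` amounts to a matrix with rows `i`, columns `(n, m)`
and entries the coefficient of `x^{p(m+1)}` in `x^i f^n`; for fixed `n`, the index `m` runs over the
monomials in `H(ℓ,J)` but not in `H(ℓ,J-1)`.

Match row `i` with column `(n, m)` when `p(m+1) = nd + i` or `p(m+1) = nd - i`, within suitable
ranges (`IsIndex`). A row is matched at most once (`IsIndex.ext`). All rows are matched if `J ≥
(p+1)/2` (`exists_isIndex_row`), all columns if `J ≤ (p+1)/2` (`exists_isIndex_column`). The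
nonvanishing of one square minor, `genericDet`, therefore gives both claims, and `U` is the locus
where `a_d` and these minors are nonzero.

That the minor is not identically zero is seen on `x^d + ∑ T^{10d²-e²} x^{d-e}`
(`det_levelMatrix_special_ne_zero`). The strictly concave exponents make the matched entries
dominate: after rescaling rows and columns by powers of `T`, the matrix is an invertible diagonal
matrix modulo `T`. -/

theorem aeval_xFun (P : K[X]) :
    aeval (xFun p a) P = AdjoinRoot.of _ (algebraMap K[X] (RatFunc K) P) := by
  have h : (aeval (xFun p a) : K[X] →ₐ[K] FunField p a).toRingHom =
      (AdjoinRoot.of _).comp (algebraMap K[X] (RatFunc K)) := by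
    refine Polynomial.ringHom_ext (fun c => ?_) ?_
    · simp only [AlgHom.toRingHom_eq_coe, RingHom.coe_coe, aeval_C, RingHom.comp_apply]
      exact congrArg (AdjoinRoot.of _) (IsScalarTower.algebraMap_apply K K[X] (RatFunc K) c)
    · simp [xFun, RatFunc.algebraMap_X]
  exact congrArg (fun φ : K[X] →+* FunField p a => φ P) h

theorem artinSchreierPoly_natDegree [Fact p.Prime] (f : RatFunc K) :
    (X ^ p - X - C f : (RatFunc K)[X]).natDegree = p := by
  have hp : 1 < p := (Fact.out : p.Prime).one_lt
  rw [natDegree_sub_C, natDegree_sub_eq_left_of_natDegree_lt] <;> simp [hp]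

theorem artinSchreierPoly_monic [Fact p.Prime] (f : RatFunc K) :
    (X ^ p - X - C f : (RatFunc K)[X]).Monic := by
  have hp : 1 < p := (Fact.out : p.Prime).one_lt
  rw [sub_sub]
  refine monic_X_pow_sub ?_
  refine (degree_add_le _ _).trans_lt ?_
  refine max_lt ?_ ?_
  · rw [degree_X]; exact_mod_cast hp
  · refine degree_C_le.trans_lt ?_; exact_mod_cast hp.trans' zero_lt_one

theorem yFun_pow [Fact p.Prime] :
    yFun p a ^ p = yFun p a + aeval (xFun p a) (fPoly a) := by
  have h := AdjoinRoot.eval₂_root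
    (X ^ p - X - C (algebraMap K[X] (RatFunc K) (fPoly a)) : (RatFunc K)[X])
  simp only [eval₂_sub, eval₂_pow, eval₂_X, eval₂_C] at h
  rw [aeval_xFun, yFun]
  linear_combination h

theorem funField_nontrivial [Fact p.Prime] : Nontrivial (FunField p a) := by
  refine AdjoinRoot.nontrivial _ ?_
  rw [degree_eq_natDegree (artinSchreierPoly_monic _).ne_zero, artinSchreierPoly_natDegree]
  exact_mod_cast (Fact.out : p.Prime).ne_zero

theorem funField_charP [Fact p.Prime] [CharP K p] : CharP (FunField p a) p :=
  have := funField_nontrivial (p := p) (a := a)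
  charP_of_injective_algebraMap (algebraMap K (FunField p a)).injective p

/-- The powers `1, y, …, y^{p-1}` are linearly independent over `K(x)`. -/
theorem coeff_eq_zero_of_sum_yFun [Fact p.Prime] (r : ℕ → RatFunc K)
    (h : ∑ j ∈ Finset.range p, AdjoinRoot.of _ (r j) * yFun p a ^ j = 0) :
    ∀ j < p, r j = 0 := by
  set g : (RatFunc K)[X] := X ^ p - X - C (algebraMap K[X] (RatFunc K) (fPoly a)) with hg
  set q : (RatFunc K)[X] := ∑ j ∈ Finset.range p, C (r j) * X ^ j with hq
  have h1 : AdjoinRoot.mk g q = 0 := by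
    rw [hq, map_sum, ← h]
    refine Finset.sum_congr rfl fun j _ => ?_
    rw [map_mul, map_pow, AdjoinRoot.mk_C, AdjoinRoot.mk_X]
    rfl
  have hdeg : q.degree < g.degree := by
    rw [degree_eq_natDegree (artinSchreierPoly_monic _).ne_zero, artinSchreierPoly_natDegree]
    refine (degree_sum_le _ _).trans_lt ?_
    rw [Finset.sup_lt_iff (by exact WithBot.bot_lt_coe p)]
    intro j hj
    refine (degree_C_mul_X_pow_le _ _).trans_lt ?_
    exact_mod_cast Finset.mem_range.1 hj
  have h0 : q = 0 := eq_zero_of_dvd_of_degree_lt (AdjoinRoot.mk_eq_zero.1 h1) hdeg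
  intro j hj
  have := congrArg (fun q => coeff q j) h0
  simpa [hq, finsetSum_coeff, coeff_C_mul, coeff_X_pow, hj] using this

theorem exists_sum_yFun [Fact p.Prime] (z : FunField p a) :
    ∃ r : ℕ → RatFunc K, z = ∑ j ∈ Finset.range p, AdjoinRoot.of _ (r j) * yFun p a ^ j := by
  obtain ⟨q, rfl⟩ := AdjoinRoot.mk_surjective z
  set g : (RatFunc K)[X] := X ^ p - X - C (algebraMap K[X] (RatFunc K) (fPoly a)) with hg
  have hm : g.Monic := artinSchreierPoly_monic _
  have hgd : g.natDegree = p := artinSchreierPoly_natDegree _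
  have h1 : AdjoinRoot.mk g q = AdjoinRoot.mk g (q %ₘ g) := by
    rw [AdjoinRoot.mk_eq_mk]
    exact ⟨q /ₘ g, by linear_combination - modByMonic_add_div q g⟩
  have h2 : (q %ₘ g).natDegree < p := by
    rw [← hgd]
    refine natDegree_modByMonic_lt q hm fun h => ?_
    rw [h, natDegree_one] at hgd
    exact (Fact.out : p.Prime).ne_zero hgd.symm
  refine ⟨(q %ₘ g).coeff, ?_⟩
  rw [h1]
  conv_lhs => rw [as_sum_range_C_mul_X_pow' _ h2]
  rw [map_sum]
  refine Finset.sum_congr rfl fun j _ => ?_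
  rw [map_mul, map_pow, AdjoinRoot.mk_C, AdjoinRoot.mk_X]
  rfl

/-- The powers `1, y^p, …, y^{p(p-1)}` are linearly independent over `K(x)`. -/
theorem coeff_eq_zero_of_sum_yFun_pow [Fact p.Prime] (r : ℕ → RatFunc K)
    (h : ∑ j ∈ Finset.range p, AdjoinRoot.of _ (r j) * (yFun p a ^ p) ^ j = 0) :
    ∀ j < p, r j = 0 := by
  set F : RatFunc K := algebraMap K[X] (RatFunc K) (fPoly a)
  set q : (RatFunc K)[X] := ∑ j ∈ Finset.range p, C (r j) * X ^ j with hq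
  have hqd : (taylor F q).natDegree < p := by
    rw [natDegree_taylor]
    have hp : 0 < p := (Fact.out : p.Prime).pos
    refine (natDegree_sum_le_of_forall_le (n := p - 1) _ _ fun j hj => ?_).trans_lt (by omega)
    have := Finset.mem_range.1 hj
    exact (natDegree_C_mul_X_pow_le _ _).trans (by omega)
  -- Since `y^p = y + F`, a polynomial in `y^p` is its Taylor shift by `F` evaluated at `y`, and the
  -- shift keeps the degree below `p`.
  have h1 : ∑ j ∈ Finset.range p, AdjoinRoot.of _ ((taylor F q).coeff j) * yFun p a ^ j = 0 := by
    rw [← h]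
    have e1 : ∑ j ∈ Finset.range p, AdjoinRoot.of _ ((taylor F q).coeff j) * yFun p a ^ j =
        eval₂ (AdjoinRoot.of _) (yFun p a) (taylor F q) :=
      (eval₂_eq_sum_range' (AdjoinRoot.of _) hqd _).symm
    rw [e1, taylor_apply, eval₂_comp, hq, eval₂_finsetSum]
    refine Finset.sum_congr rfl fun j _ => ?_
    simp only [eval₂_mul, eval₂_C, eval₂_pow, eval₂_X, eval₂_add]
    rw [yFun_pow, aeval_xFun]
  have h2 := coeff_eq_zero_of_sum_yFun _ h1
  have h3 : taylor F q = 0 := by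
    ext j
    by_cases hj : j < p
    · simpa using h2 j hj
    · rw [coeff_eq_zero_of_natDegree_lt (by omega), coeff_zero]
  have h4 : q = 0 := by
    apply taylor_injective F
    rw [h3, map_zero]
  intro j hj
  have := congrArg (fun q => coeff q j) h4
  simpa [hq, finsetSum_coeff, coeff_C_mul, coeff_X_pow, hj] using this

/-! ### Independence over `p`-th powers. -/

/-- The coefficients of `P ^ p` in characteristic `p`. -/
theorem coeff_pow_char [Fact p.Prime] [CharP K p] (P : K[X]) (m n : ℕ) (hn : n < p) :
    (P ^ p).coeff (p * m + n) = if n = 0 then P.coeff m ^ p else 0 := by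
  have hp : 0 < p := (Fact.out : p.Prime).pos
  have h : (expand K p P).map (frobenius K p) = P ^ p := map_frobenius_expand p P
  rw [← h, coeff_map, coeff_expand hp]
  split_ifs with h1 h2 h2
  · subst h2
    simp [frobenius_def, hp]
  · exact absurd ((Nat.dvd_add_right (dvd_mul_right p m)).1 h1)
      (fun h => h2 (Nat.eq_zero_of_dvd_of_lt h hn))
  · subst h2; exact absurd (dvd_mul_right p m) h1
  · simp

theorem coeff_sum_pow_mul_X_pow [Fact p.Prime] [CharP K p] (P : ℕ → K[X]) (m n : ℕ) (hn : n < p) :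
    (∑ i ∈ Finset.range p, P i ^ p * X ^ i).coeff (p * m + n) = (P n).coeff m ^ p := by
  rw [finsetSum_coeff, Finset.sum_eq_single n]
  · rw [coeff_mul_X_pow', if_pos (by omega), Nat.add_sub_cancel]
    simpa using coeff_pow_char (P n) m 0 (Fact.out : p.Prime).pos
  · intro i hi hin
    have hi := Finset.mem_range.1 hi
    rw [coeff_mul_X_pow']
    split_ifs with h
    · rcases lt_or_gt_of_ne hin with h1 | h1
      · rw [show p * m + n - i = p * m + (n - i) by omega, coeff_pow_char _ _ _ (by omega),
          if_neg (by omega)]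
      · obtain ⟨m, rfl⟩ : ∃ m', m = m' + 1 := ⟨m - 1, by
          rcases Nat.eq_zero_or_pos m with rfl | h2 <;> omega⟩
        rw [show p * (m + 1) + n - i = p * m + (p + n - i) by rw [mul_add]; omega,
          coeff_pow_char _ _ _ (by omega), if_neg (by omega)]
    · rfl
  · intro h; exact absurd (Finset.mem_range.2 hn) h

/-- After clearing denominators, the summands involve exponents in different residue classes modulo
`p`, so they cannot cancel. -/
theorem eq_zero_of_sum_pow_mul_X_pow [Fact p.Prime] [CharP K p] (r : ℕ → RatFunc K)
    (h : ∑ n ∈ Finset.range p, r n ^ p * RatFunc.X ^ n = 0) : ∀ n < p, r n = 0 := by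
  classical
  obtain ⟨b, hb⟩ := IsLocalization.exist_integer_multiples_of_finset (nonZeroDivisors K[X])
    ((Finset.range p).image r)
  have hb' : ∀ n, ∃ P : K[X], n < p →
      algebraMap K[X] (RatFunc K) P = algebraMap K[X] (RatFunc K) b * r n := by
    intro n
    by_cases hn : n < p
    · obtain ⟨P, hP⟩ := hb (r n) (Finset.mem_image_of_mem _ (Finset.mem_range.2 hn))
      refine ⟨P, fun _ => ?_⟩
      rw [hP, Algebra.smul_def]
    · exact ⟨0, fun h => absurd h hn⟩
  choose P hP using hb'
  have hinj : Function.Injective (algebraMap K[X] (RatFunc K)) := IsFractionRing.injective _ _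
  have hsum : ∑ n ∈ Finset.range p, P n ^ p * X ^ n = 0 := by
    apply hinj
    rw [map_sum, map_zero, ← mul_zero (algebraMap K[X] (RatFunc K) b ^ p), ← h, Finset.mul_sum]
    refine Finset.sum_congr rfl fun n hn => ?_
    rw [map_mul, map_pow, map_pow, hP n (Finset.mem_range.1 hn), RatFunc.algebraMap_X]
    ring
  intro n hn
  have hPn : P n = 0 := by
    ext m
    have := coeff_sum_pow_mul_X_pow P m n hn
    rw [hsum, coeff_zero] at this
    simpa using pow_eq_zero_iff (Fact.out : p.Prime).ne_zero |>.1 this.symm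
  have h1 := hP n hn
  rw [hPn, map_zero] at h1
  rcases mul_eq_zero.1 h1.symm with h2 | h2
  · exact absurd (hinj (h2.trans (map_zero _).symm)) (nonZeroDivisors.coe_ne_zero b)
  · exact h2

/-- The powers `1, x, …, x^{p-1}` are linearly independent over the `p`-th powers of `K(Y_a)`. -/
theorem eq_zero_of_sum_pow_mul_xFun_pow [Fact p.Prime] [CharP K p] (g : ℕ → FunField p a)
    (h : ∑ n ∈ Finset.range p, g n ^ p * xFun p a ^ n = 0) : ∀ n < p, g n = 0 := by
  have := funField_charP (p := p) (a := a)
  choose r hr using fun n => exists_sum_yFun (g n)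
  have hpow : ∀ n, g n ^ p =
      ∑ j ∈ Finset.range p, AdjoinRoot.of _ (r n j ^ p) * (yFun p a ^ p) ^ j := by
    intro n
    conv_lhs => rw [hr n]
    rw [sum_pow_char]
    refine Finset.sum_congr rfl fun j _ => ?_
    rw [mul_pow, map_pow, ← pow_mul, ← pow_mul, mul_comm p j]
  -- Regrouping by powers of `y^p` reduces the claim to the same statement over `K(x)`.
  have h1 : ∑ j ∈ Finset.range p,
      AdjoinRoot.of _ (∑ n ∈ Finset.range p, r n j ^ p * RatFunc.X ^ n) * (yFun p a ^ p) ^ j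
        = 0 := by
    rw [← h]
    simp_rw [hpow, Finset.sum_mul, map_sum, Finset.sum_mul]
    rw [Finset.sum_comm]
    refine Finset.sum_congr rfl fun n _ => Finset.sum_congr rfl fun j _ => ?_
    rw [map_mul, map_pow _ RatFunc.X, ← xFun]
    ring
  have h2 := coeff_eq_zero_of_sum_yFun_pow _ h1
  intro n hn
  rw [hr n]
  refine Finset.sum_eq_zero fun j hj => ?_
  rw [eq_zero_of_sum_pow_mul_X_pow _ (h2 j (Finset.mem_range.1 hj)) n hn, map_zero, zero_mul]

theorem isUnit_aeval_xFun {P : K[X]} (hP : P ≠ 0) : IsUnit (aeval (xFun p a) P) := by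
  rw [aeval_xFun]
  refine IsUnit.map _ (IsUnit.mk0 _ ?_)
  rwa [Ne, IsFractionRing.to_map_eq_zero_iff]

/-! ### The derivation `d/dx` and uniqueness of the coefficient of `dx`. -/

theorem aeval_dualNumber (P : K[X]) :
    aeval (TrivSqZeroExt.inl (xFun p a) + DualNumber.eps : DualNumber (FunField p a)) P =
      TrivSqZeroExt.inl (aeval (xFun p a) P) +
        TrivSqZeroExt.inr (aeval (xFun p a) (derivative P)) := by
  rw [aeval_add_of_sq_eq_zero _ _ _ DualNumber.eps_pow_two]
  have h : ∀ Q : K[X], aeval (TrivSqZeroExt.inl (xFun p a) : DualNumber (FunField p a)) Q =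
      TrivSqZeroExt.inl (aeval (xFun p a) Q) := fun Q =>
    aeval_algHom_apply (TrivSqZeroExt.inlAlgHom K (FunField p a) (FunField p a)) (xFun p a) Q
  rw [h, h]
  congr 1
  ext <;> simp

/-- The deformation `K(x) → K(Y_a)[ε]`, `x ↦ x + ε`. -/
noncomputable def ratFuncToDual (a : Fin (d + 1) → K) (p : ℕ) :
    RatFunc K →+* DualNumber (FunField p a) :=
  IsLocalization.lift (M := nonZeroDivisors K[X])
    (g := (aeval (TrivSqZeroExt.inl (xFun p a) + DualNumber.eps :
      DualNumber (FunField p a)) : K[X] →ₐ[K] _).toRingHom) (by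
    intro P
    rw [TrivSqZeroExt.isUnit_iff_isUnit_fst]
    have h := isUnit_aeval_xFun (p := p) (a := a) (nonZeroDivisors.coe_ne_zero P)
    simpa [aeval_dualNumber] using h)

theorem ratFuncToDual_algebraMap (P : K[X]) :
    ratFuncToDual a p (algebraMap K[X] (RatFunc K) P) =
      TrivSqZeroExt.inl (aeval (xFun p a) P) +
        TrivSqZeroExt.inr (aeval (xFun p a) (derivative P)) := by
  rw [← aeval_dualNumber]
  exact IsLocalization.lift_eq _ _

/-- The deformation `K(Y_a) → K(Y_a)[ε]` with `x ↦ x + ε`, `y ↦ y - f'(x) ε`. -/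
noncomputable def funFieldToDual [Fact p.Prime] [CharP K p] (a : Fin (d + 1) → K) :
    FunField p a →+* DualNumber (FunField p a) :=
  AdjoinRoot.lift (ratFuncToDual a p)
    -- Differentiating `y^p - y = f` in characteristic `p` forces `y' = -f'`.
    (TrivSqZeroExt.inl (yFun p a) - TrivSqZeroExt.inr (aeval (xFun p a) (derivative (fPoly a))))
    (by
      have := funField_charP (p := p) (a := a)
      simp only [eval₂_sub, eval₂_pow, eval₂_X, eval₂_C]
      rw [ratFuncToDual_algebraMap]
      ext
      · simp [TrivSqZeroExt.fst_pow, yFun_pow]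
      · simp [TrivSqZeroExt.snd_pow])

theorem fst_funFieldToDual [Fact p.Prime] [CharP K p] (z : FunField p a) :
    (funFieldToDual a z).fst = z := by
  have h : ((TrivSqZeroExt.fstHom K (FunField p a) (FunField p a)).toRingHom.comp
      (funFieldToDual a)) = RingHom.id (FunField p a) := by
    refine AdjoinRoot.ringHom_ext ?_ ?_
    · refine IsLocalization.ringHom_ext (nonZeroDivisors K[X]) (RingHom.ext fun P => ?_)
      have : funFieldToDual a (AdjoinRoot.of _ (algebraMap K[X] (RatFunc K) P)) =
          ratFuncToDual a p (algebraMap K[X] (RatFunc K) P) := AdjoinRoot.lift_of _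
      simp only [RingHom.comp_apply, this, ratFuncToDual_algebraMap]
      simp [aeval_xFun]
    · have : funFieldToDual a (AdjoinRoot.root _) = _ := AdjoinRoot.lift_root _
      simp only [RingHom.comp_apply, this]
      simp [yFun]
  exact congrArg (fun φ : FunField p a →+* FunField p a => φ z) h

/-- The derivation `d/dx` of `K(Y_a)`. -/
noncomputable def derivX [Fact p.Prime] [CharP K p] (a : Fin (d + 1) → K) :
    Derivation K (FunField p a) (FunField p a) :=
  Derivation.mk'
    { toFun := fun z => (funFieldToDual a z).snd
      map_add' := fun z w => by simp
      map_smul' := fun c z => by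
        have : funFieldToDual a (algebraMap K (FunField p a) c) =
            TrivSqZeroExt.inl (algebraMap K (FunField p a) c) := by
          have h1 : algebraMap K (FunField p a) c =
              AdjoinRoot.of _ (algebraMap K[X] (RatFunc K) (C c)) := by
            rw [← aeval_xFun, aeval_C]
          have h2 : funFieldToDual a (AdjoinRoot.of _ (algebraMap K[X] (RatFunc K) (C c))) =
              ratFuncToDual a p (algebraMap K[X] (RatFunc K) (C c)) := AdjoinRoot.lift_of _
          rw [h1, h2, ratFuncToDual_algebraMap, ← aeval_xFun]
          simp
        rw [Algebra.smul_def, map_mul, this]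
        simp [Algebra.smul_def] }
    (fun z w => by
      simp [fst_funFieldToDual, mul_comm])

theorem derivX_xFun [Fact p.Prime] [CharP K p] : derivX a (xFun p a) = 1 := by
  have h : funFieldToDual a (AdjoinRoot.of _ (algebraMap K[X] (RatFunc K) X)) =
      ratFuncToDual a p (algebraMap K[X] (RatFunc K) X) := AdjoinRoot.lift_of _
  have h2 : derivX a (xFun p a) = (funFieldToDual a (xFun p a)).snd := rfl
  rw [h2, xFun, ← RatFunc.algebraMap_X, h, ratFuncToDual_algebraMap]
  simp

/-- The linear map on differentials induced by `d/dx` sends `z dx` back to `z`. -/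
theorem smul_dx_injective [Fact p.Prime] [CharP K p] :
    Function.Injective fun z : FunField p a => z • dx p a := by
  intro z w h
  have := congrArg (derivX a).liftKaehlerDifferential h
  simpa [dx, derivX_xFun] using this

/-- The value of the Cartier operator on a differential given in the form that defines it. -/
theorem cartier_sum [Fact p.Prime] [CharP K p] (g : ℕ → FunField p a) :
    cartier p a ((∑ n ∈ Finset.range p, g n ^ p * xFun p a ^ n) • dx p a) =
      g (p - 1) • dx p a := by
  have := funField_charP (p := p) (a := a)
  have hp := (Fact.out : p.Prime).pos
  have h : ∃ g' : ℕ → FunField p a, (∑ n ∈ Finset.range p, g n ^ p * xFun p a ^ n) • dx p a =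
      (∑ n ∈ Finset.range p, g' n ^ p * xFun p a ^ n) • dx p a := ⟨g, rfl⟩
  rw [cartier, dif_pos h]
  have h1 := smul_dx_injective h.choose_spec
  have h2 : ∑ n ∈ Finset.range p, (g - h.choose) n ^ p * xFun p a ^ n = 0 := by
    simp_rw [Pi.sub_apply, sub_pow_char, sub_mul, Finset.sum_sub_distrib]
    exact sub_eq_zero.2 h1
  have h3 := eq_zero_of_sum_pow_mul_xFun_pow _ h2 (p - 1) (by omega)
  rw [sub_eq_zero.1 h3]

/-! ### The Cartier operator on differentials `y^{l-1} Q(x) dx`. -/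

/-- The component `P_n` of a polynomial `P = ∑ n < p, P_n ^ p * X ^ n` over a perfect field. -/
noncomputable def frobSection (p : ℕ) [ExpChar K p] [PerfectRing K p] (n : ℕ) (P : K[X]) : K[X] :=
  ∑ m ∈ Finset.range (P.natDegree + 1),
    monomial m ((frobeniusEquiv K p).symm (P.coeff (p * m + n)))

theorem coeff_frobSection [Fact p.Prime] [CharP K p] [PerfectRing K p] (n m : ℕ) (P : K[X]) :
    (frobSection p n P).coeff m = (frobeniusEquiv K p).symm (P.coeff (p * m + n)) := by
  have hp := (Fact.out : p.Prime).pos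
  simp only [frobSection, finsetSum_coeff, coeff_monomial, Finset.sum_ite_eq', Finset.mem_range]
  split_ifs with h
  · rfl
  · have : m ≤ p * m := Nat.le_mul_of_pos_left m hp
    rw [coeff_eq_zero_of_natDegree_lt (by omega), map_zero]

theorem sum_frobSection [Fact p.Prime] [CharP K p] [PerfectRing K p] (P : K[X]) :
    ∑ n ∈ Finset.range p, frobSection p n P ^ p * X ^ n = P := by
  have hp := (Fact.out : p.Prime).pos
  ext e
  rw [← Nat.div_add_mod e p, coeff_sum_pow_mul_X_pow _ _ _ (Nat.mod_lt _ hp), coeff_frobSection]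
  exact frobeniusEquiv_symm_pow_p _ _ _

/-- The differential `y^{l-1} Q(x) dx`. -/
noncomputable def polyDiff (p : ℕ) (a : Fin (d + 1) → K) (l : ℕ) (Q : K[X]) : Diff p a :=
  (yFun p a ^ (l - 1) * aeval (xFun p a) Q) • dx p a

theorem polyDiff_add (l : ℕ) (P Q : K[X]) :
    polyDiff p a l (P + Q) = polyDiff p a l P + polyDiff p a l Q := by
  simp [polyDiff, mul_add, add_smul]

theorem polyDiff_sub (l : ℕ) (P Q : K[X]) :
    polyDiff p a l (P - Q) = polyDiff p a l P - polyDiff p a l Q := by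
  simp [polyDiff, mul_sub, sub_smul]

theorem polyDiff_smul (l : ℕ) (c : K) (Q : K[X]) :
    polyDiff p a l (c • Q) = c • polyDiff p a l Q := by
  simp only [polyDiff, map_smul, mul_smul_comm, smul_assoc]

theorem mem_span_omega_iff (S : ℕ → Prop) (l : ℕ) (ω : Diff p a) :
    ω ∈ Submodule.span K {ω | ∃ i : ℕ, 0 < i ∧ S i ∧ ω = omega p a i l} ↔
      ∃ Q : K[X], (∀ m, Q.coeff m ≠ 0 → S (m + 1)) ∧ ω = polyDiff p a l Q := by
  constructor
  · intro h
    induction h using Submodule.span_induction with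
    | mem ω h =>
      obtain ⟨i, hi, hS, rfl⟩ := h
      refine ⟨X ^ (i - 1), fun m hm => ?_, ?_⟩
      · rw [coeff_X_pow] at hm
        split_ifs at hm with h
        · rw [h, Nat.sub_add_cancel hi]; exact hS
        · exact absurd rfl hm
      · simp [omega, polyDiff]
    | zero => exact ⟨0, fun m hm => absurd (coeff_zero m) hm, by simp [polyDiff]⟩
    | add ω η _ _ h1 h2 =>
      obtain ⟨P, hP, rfl⟩ := h1
      obtain ⟨Q, hQ, rfl⟩ := h2
      refine ⟨P + Q, fun m hm => ?_, (polyDiff_add _ _ _).symm⟩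
      by_cases h : P.coeff m = 0
      · exact hQ m fun h' => hm (by rw [coeff_add, h, h', add_zero])
      · exact hP m h
    | smul c ω _ h1 =>
      obtain ⟨P, hP, rfl⟩ := h1
      refine ⟨c • P, fun m hm => hP m fun h => hm ?_, (polyDiff_smul _ _ _).symm⟩
      rw [coeff_smul, h, smul_zero]
  · rintro ⟨Q, hQ, rfl⟩
    rw [polyDiff, aeval_eq_sum_range, Finset.mul_sum, Finset.sum_smul]
    refine Submodule.sum_mem _ fun m _ => ?_
    rw [mul_smul_comm, smul_assoc]
    by_cases h : Q.coeff m = 0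
    · rw [h, zero_smul]; exact Submodule.zero_mem _
    · exact Submodule.smul_mem _ _ (Submodule.subset_span ⟨m + 1, by omega, hQ m h, by simp [omega]⟩)

/-- The monomials allowed in `Q` when `y^{l-1} Q(x) dx ∈ H(l,e)`. -/
def LevelSupport (p d l e : ℕ) (Q : K[X]) : Prop :=
  ∀ m, Q.coeff m ≠ 0 → (p : ℤ) ^ 2 * (m + 1) ≤ (p * (e + 1 - l) - e) * d

/-- The monomials allowed in `P` when `y^{J-1} P(x) dx ∈ ′H^J`. -/
def PrimeSupport (p d J : ℕ) (P : K[X]) : Prop :=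
  ∀ m, P.coeff m ≠ 0 → (p : ℤ) * (m + 1) < (p - J) * d ∧ ¬ p ∣ m + 1

theorem mem_HLevel_iff (hp : 0 < p) {l e : ℕ} (hle : l ≤ e) (ω : Diff p a) :
    ω ∈ HLevel p a l e ↔ ∃ Q : K[X], LevelSupport p d l e Q ∧ ω = polyDiff p a l Q := by
  have hS : {ω | l ≤ e ∧ ∃ i : ℕ, 0 < i ∧
      (i : ℤ) ≤ ⌊((p : ℚ) * (e + 1 - l) - e) * d / (p : ℚ) ^ 2⌋ ∧ ω = omega p a i l} =
      {ω | ∃ i : ℕ, 0 < i ∧ ((p : ℤ) ^ 2 * i ≤ (p * (e + 1 - l) - e) * d) ∧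
        ω = omega p a i l} := by
    ext ω
    simp only [Set.mem_ofPred_eq, hle, true_and]
    refine exists_congr fun i => and_congr_right fun _ => and_congr_left fun _ => ?_
    have hp' : (0 : ℚ) < (p : ℚ) ^ 2 := by positivity
    rw [Int.le_floor, le_div_iff₀ hp', mul_comm]
    exact_mod_cast Iff.rfl
  rw [HLevel, hS, mem_span_omega_iff]
  simp [LevelSupport]

theorem mem_HPrime_iff (hp : 0 < p) {J : ℕ} (ω : Diff p a) :
    ω ∈ HPrime p a J ↔ ∃ P : K[X], PrimeSupport p d J P ∧ ω = polyDiff p a J P := by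
  have hS : {ω | ∃ i : ℕ, 0 < i ∧ (i : ℚ) < ((p : ℚ) - J) * d / p ∧ ¬ p ∣ i ∧
      ω = omega p a i J} =
      {ω | ∃ i : ℕ, 0 < i ∧ ((p : ℤ) * i < (p - J) * d ∧ ¬ p ∣ i) ∧ ω = omega p a i J} := by
    ext ω
    simp only [Set.mem_ofPred_eq, and_assoc]
    refine exists_congr fun i => and_congr_right fun _ => and_congr_left fun _ => ?_
    have hp' : (0 : ℚ) < (p : ℚ) := by positivity
    rw [lt_div_iff₀ hp', mul_comm]
    exact_mod_cast Iff.rfl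
  rw [HPrime, hS, mem_span_omega_iff]
  simp [PrimeSupport]

/-- The coefficient of `y^{l-1} dx` in `𝒞(y^{J-1} P(x) dx)`. -/
noncomputable def cartierPoly (p : ℕ) [ExpChar K p] [PerfectRing K p] (f : K[X]) (J l : ℕ)
    (P : K[X]) : K[X] :=
  C ((J - 1).choose (l - 1) : K) * frobSection p (p - 1) ((-f) ^ (J - l) * P)

theorem cartier_polyDiff [Fact p.Prime] [CharP K p] [PerfectRing K p] {J : ℕ} (P : K[X])
    (hP : ∀ m, P.coeff m ≠ 0 → ¬ p ∣ m + 1) (hJ : 0 < J) :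
    cartier p a (polyDiff p a J P) =
      ∑ l ∈ Finset.Ico 1 J, polyDiff p a l (cartierPoly p (fPoly a) J l P) := by
  have := funField_charP (p := p) (a := a)
  have hp := (Fact.out : p.Prime).pos
  obtain ⟨J, rfl⟩ : ∃ J', J = J' + 1 := ⟨J - 1, by omega⟩
  set f := fPoly a
  let g : ℕ → FunField p a := fun n => ∑ l ∈ Finset.range (J + 1),
    (J.choose l : FunField p a) * yFun p a ^ l *
      aeval (xFun p a) (frobSection p n ((-f) ^ (J - l) * P))
  have hg : yFun p a ^ J * aeval (xFun p a) P =
      ∑ n ∈ Finset.range p, g n ^ p * xFun p a ^ n := by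
    -- The binomial expansion of this relation makes every power of `y` a `p`-th power; only the
    -- polynomial factors in `x` remain to be split.
    have h1 : yFun p a = yFun p a ^ p + aeval (xFun p a) (-f) := by
      rw [yFun_pow, map_neg]; ring
    have h2 : ∀ n, g n ^ p = ∑ l ∈ Finset.range (J + 1),
        (J.choose l : FunField p a) * (yFun p a ^ p) ^ l *
          aeval (xFun p a) (frobSection p n ((-f) ^ (J - l) * P) ^ p) := by
      intro n
      rw [sum_pow_char]
      refine Finset.sum_congr rfl fun l _ => ?_
      rw [mul_pow, mul_pow, map_pow]
      congr 2
      · rw [← frobenius_def, map_natCast]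
      · rw [← pow_mul, ← pow_mul, mul_comm]
    conv_lhs => rw [h1, add_pow, Finset.sum_mul]
    simp_rw [h2, Finset.sum_mul]
    rw [Finset.sum_comm]
    refine Finset.sum_congr rfl fun l _ => ?_
    have h3 := congrArg (aeval (xFun p a)) (sum_frobSection (p := p) ((-f) ^ (J - l) * P))
    rw [map_mul, map_pow] at h3
    rw [show ∀ u v w z : FunField p a, u * v * w * z = w * u * (v * z) by intros; ring, ← h3,
      map_sum, Finset.mul_sum]
    refine Finset.sum_congr rfl fun n _ => ?_
    rw [map_mul, map_pow _ X, aeval_X]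
    ring
  -- The term of top degree in `y` vanishes: the condition `p ∤ i` excludes exactly the exponents `i
  -- - 1 ≡ p - 1` modulo `p`.
  have h4 : frobSection p (p - 1) P = 0 := by
    ext m
    rw [coeff_frobSection, coeff_zero]
    have : P.coeff (p * m + (p - 1)) = 0 := by
      by_contra h
      refine hP _ h ⟨m + 1, ?_⟩
      rw [mul_add, mul_one]; omega
    rw [this, map_zero]
  rw [polyDiff, Nat.add_sub_cancel, hg, cartier_sum]
  simp only [g]
  rw [Finset.sum_range_succ, Nat.sub_self, pow_zero, one_mul, h4, map_zero, mul_zero, add_zero,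
    Finset.sum_Ico_eq_sum_range, Finset.sum_smul]
  refine Finset.sum_congr (by simp) fun l _ => ?_
  rw [polyDiff, cartierPoly, Nat.add_sub_cancel, Nat.add_sub_cancel_left,
    show J + 1 - (1 + l) = J - l by omega]
  congr 1
  rw [map_mul, aeval_C, map_natCast]
  ring

theorem eq_zero_of_sum_polyDiff [Fact p.Prime] [CharP K p] {J : ℕ} (hJ : J < p) (Q : ℕ → K[X])
    (h : ∑ l ∈ Finset.Ico 1 J, polyDiff p a l (Q l) = 0) : ∀ l ∈ Finset.Ico 1 J, Q l = 0 := by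
  set r : ℕ → RatFunc K := fun j =>
    if j + 1 < J then algebraMap K[X] (RatFunc K) (Q (j + 1)) else 0 with hr
  have h1 : ∑ j ∈ Finset.range p, AdjoinRoot.of _ (r j) * yFun p a ^ j = 0 := by
    have h2 : (∑ j ∈ Finset.range p, AdjoinRoot.of _ (r j) * yFun p a ^ j) • dx p a =
        (0 : FunField p a) • dx p a := by
      rw [zero_smul, ← h, Finset.sum_smul, Finset.sum_Ico_eq_sum_range]
      symm
      refine Finset.sum_subset_zero_on_sdiff (Finset.range_subset_range.2 (by omega)) ?_ ?_
      · intro j hj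
        simp only [Finset.mem_sdiff, Finset.mem_range] at hj
        simp only [hr]
        rw [if_neg (by omega), map_zero, zero_mul, zero_smul]
      · intro j hj
        have hj := Finset.mem_range.1 hj
        simp only [hr]
        rw [if_pos (by omega), polyDiff, Nat.add_sub_cancel_left, aeval_xFun, mul_comm,
          add_comm 1 j]
    exact smul_dx_injective h2
  intro l hl
  rw [Finset.mem_Ico] at hl
  have h2 := coeff_eq_zero_of_sum_yFun r h1 (l - 1) (by omega)
  simp only [hr] at h2
  rw [if_pos (by omega), Nat.sub_add_cancel hl.1] at h2
  exact IsFractionRing.injective K[X] (RatFunc K) (h2.trans (map_zero _).symm)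

theorem polyDiff_injective [Fact p.Prime] [CharP K p] {l : ℕ} (h0 : 0 < l) (hl : l < p) :
    Function.Injective (polyDiff p a l) := by
  intro P Q h
  have h1 : (yFun p a ^ (l - 1) * aeval (xFun p a) (P - Q)) = 0 := by
    apply smul_dx_injective
    simpa [polyDiff, mul_sub, sub_smul, sub_eq_zero] using h
  have h2 := coeff_eq_zero_of_sum_yFun (p := p) (a := a)
    (fun j => if j = l - 1 then algebraMap K[X] (RatFunc K) (P - Q) else 0) (by
      rw [Finset.sum_eq_single (l - 1)]
      · rw [if_pos rfl, ← aeval_xFun, mul_comm, h1]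
      · intro j _ hj
        rw [if_neg hj, map_zero, zero_mul]
      · intro h; exact absurd (Finset.mem_range.2 (by omega)) h) (l - 1) (by omega)
  rw [if_pos rfl] at h2
  exact sub_eq_zero.1 (IsFractionRing.injective K[X] (RatFunc K) (h2.trans (map_zero _).symm))

theorem natDegree_fPoly_le : (fPoly a).natDegree ≤ d := by
  refine natDegree_sum_le_of_forall_le _ _ fun i _ => ?_
  exact (natDegree_C_mul_X_pow_le _ _).trans (Nat.lt_succ_iff.1 i.2)

/-- A degree count: `p(m+1)` is at most `(J-l)d` plus a row index `i` with `pi < (p-J)d`;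
multiplying by `p` gives the bound defining `H(l,J)`. -/
theorem levelSupport_cartierPoly [Fact p.Prime] [CharP K p] [PerfectRing K p] {J l : ℕ}
    {P : K[X]} (hP : PrimeSupport p d J P) (hl : l ∈ Finset.Ico 1 J) :
    LevelSupport p d l J (cartierPoly p (fPoly a) J l P) := by
  rw [Finset.mem_Ico] at hl
  have hp := (Fact.out : p.Prime).pos
  intro m hm
  rw [cartierPoly, coeff_C_mul, coeff_frobSection] at hm
  have h1 : (((-fPoly a) ^ (J - l) * P)).coeff (p * m + (p - 1)) ≠ 0 := by
    intro h; rw [h, map_zero, mul_zero] at hm; exact hm rfl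
  rw [coeff_mul] at h1
  obtain ⟨⟨u, v⟩, huv, hne⟩ := Finset.exists_ne_zero_of_sum_ne_zero h1
  rw [Finset.HasAntidiagonal.mem_antidiagonal] at huv
  simp only at huv hne
  have h2 := (hP v (right_ne_zero_of_mul hne)).1
  have h3 : u ≤ (J - l) * d := by
    refine (le_natDegree_of_ne_zero (left_ne_zero_of_mul hne)).trans ?_
    refine natDegree_pow_le.trans (Nat.mul_le_mul_left _ ?_)
    rw [natDegree_neg]; exact natDegree_fPoly_le
  have h4 : (u : ℤ) ≤ (J - l) * d := by
    have : ((J - l : ℕ) : ℤ) = J - l := by push_cast [hl.2.le]; ring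
    rw [← this]; exact_mod_cast h3
  have h5 : (p : ℤ) * (m + 1) = u + (v + 1) := by
    have : p * m + p = u + v + 1 := by omega
    have := congrArg (Nat.cast : ℕ → ℤ) this
    push_cast at this
    linarith
  have h6 : (0 : ℤ) < p := by exact_mod_cast hp
  nlinarith

/-- The sum of the `H(l,J)` is direct because distinct powers of `y` below `p` are independent over
`K(x)`. -/
theorem unique_components [Fact p.Prime] [CharP K p] {J : ℕ} (hJ : J < p)
    (η θ : (l : Finset.Ico 1 J) → HLevel p a l J)
    (h : ∑ l, (η l : Diff p a) = ∑ l, (θ l : Diff p a)) : η = θ := by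
  have hp := (Fact.out : p.Prime).pos
  have hη : ∀ l : ℕ, ∃ Q : K[X], ∀ hl : l ∈ Finset.Ico 1 J,
      ((η ⟨l, hl⟩ : Diff p a) - θ ⟨l, hl⟩) = polyDiff p a l Q := by
    intro l
    by_cases hl : l ∈ Finset.Ico 1 J
    · obtain ⟨Q, -, hQ⟩ := (mem_HLevel_iff hp (Finset.mem_Ico.1 hl).2.le _).1
        (η ⟨l, hl⟩ - θ ⟨l, hl⟩).2
      exact ⟨Q, fun _ => hQ⟩
    · exact ⟨0, fun h => absurd h hl⟩
  choose Q hQ using hη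
  have h0 : ∑ l ∈ Finset.Ico 1 J, polyDiff p a l (Q l) = 0 := by
    rw [← Finset.sum_coe_sort, ← sub_eq_zero.2 h, ← Finset.sum_sub_distrib]
    exact Finset.sum_congr rfl fun l _ => (hQ l l.2).symm
  ext l
  have h1 := hQ l l.2
  rw [eq_zero_of_sum_polyDiff hJ Q h0 l l.2] at h1
  simpa [polyDiff, sub_eq_zero] using h1

theorem exists_components [Fact p.Prime] [CharP K p] [PerfectRing K p] {J : ℕ} (hJ0 : 0 < J)
    {P : K[X]} (hP : PrimeSupport p d J P) :
    ∃ η : (l : Finset.Ico 1 J) → HLevel p a l J,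
      (∀ l, (η l : Diff p a) = polyDiff p a l (cartierPoly p (fPoly a) J l P)) ∧
      ∑ l, (η l : Diff p a) = cartier p a (polyDiff p a J P) := by
  have hp := (Fact.out : p.Prime).pos
  refine ⟨fun l => ⟨polyDiff p a l (cartierPoly p (fPoly a) J l P),
    (mem_HLevel_iff hp (Finset.mem_Ico.1 l.2).2.le _).2 ⟨_, levelSupport_cartierPoly hP l.2, rfl⟩⟩,
    fun l => rfl, ?_⟩
  rw [cartier_polyDiff P (fun m hm => (hP m hm).2) hJ0]
  exact Finset.sum_coe_sort (Finset.Ico 1 J)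
    fun l => polyDiff p a l (cartierPoly p (fPoly a) J l P)

theorem existsUnique_components [Fact p.Prime] [CharP K p] [PerfectRing K p] {J : ℕ} (hJ0 : 0 < J)
    (hJ : J < p) (ω : Diff p a) (hω : ω ∈ HPrime p a J) :
    ∃! η : (l : Finset.Ico 1 J) → HLevel p a l J, ∑ l, (η l : Diff p a) = cartier p a ω := by
  have hp := (Fact.out : p.Prime).pos
  obtain ⟨P, hP, rfl⟩ := (mem_HPrime_iff hp ω).1 hω
  obtain ⟨η, -, hη⟩ := exists_components (a := a) hJ0 hP
  exact ⟨η, hη, fun θ hθ => unique_components hJ θ η (hθ.trans hη.symm)⟩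

theorem cartierComponents_polyDiff [Fact p.Prime] [CharP K p] [PerfectRing K p] {J : ℕ}
    (hJ0 : 0 < J) (hJ : J < p) {P : K[X]} (hP : PrimeSupport p d J P) (l : Finset.Ico 1 J) :
    (cartierComponents p a J (polyDiff p a J P) l : Diff p a) =
      polyDiff p a l (cartierPoly p (fPoly a) J l P) := by
  obtain ⟨η, h1, h2⟩ := exists_components (a := a) hJ0 hP
  have h : ∃ η : (l : Finset.Ico 1 J) → HLevel p a l J,
      ∑ l, (η l : Diff p a) = cartier p a (polyDiff p a J P) := ⟨η, h2⟩
  rw [cartierComponents, dif_pos h, unique_components hJ _ η (h.choose_spec.trans h2.symm), h1]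

/-! ### Translation of `Φ_J` into coefficients of `f^n P`. -/

/-- The pairs `(n, m)` for which `y^{J-n-1} x^m dx` represents a basis vector of
`⨁ H(l,J) / H(l,J-1)`. -/
def IsColumn (p d J n m : ℕ) : Prop :=
  0 < n ∧ n < J ∧ ((p : ℤ) * n - (J - 1)) * d < p ^ 2 * (m + 1) ∧
    (p : ℤ) ^ 2 * (m + 1) ≤ (p * (n + 1) - J) * d

theorem coeff_cartierPoly [Fact p.Prime] [CharP K p] [PerfectRing K p] (f : K[X]) {J l : ℕ}
    (P : K[X]) (m : ℕ) : (cartierPoly p f J l P).coeff m = (J - 1).choose (l - 1) *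
      (frobeniusEquiv K p).symm ((-1) ^ (J - l) * (f ^ (J - l) * P).coeff (p * m + (p - 1))) := by
  rw [cartierPoly, coeff_C_mul, coeff_frobSection, neg_pow, mul_assoc,
    show ((-1 : K[X]) ^ (J - l)) = C ((-1) ^ (J - l)) by simp, coeff_C_mul]

theorem choose_cast_ne_zero [Fact p.Prime] [CharP K p] {n m : ℕ} (hn : n < p) (hm : m ≤ n) :
    (n.choose m : K) ≠ 0 := by
  rw [Ne, CharP.cast_eq_zero_iff K p]
  intro h
  have hp := (Fact.out : p.Prime)
  have : p ∣ n.factorial := by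
    rw [← Nat.choose_mul_factorial_mul_factorial hm, mul_assoc]
    exact h.mul_right _
  exact absurd (hp.dvd_factorial.1 this) (by omega)

theorem levelSupport_pred_iff {J l : ℕ} (hl : l ∈ Finset.Ico 1 J) {Q : K[X]}
    (hQ : LevelSupport p d l J Q) :
    LevelSupport p d l (J - 1) Q ↔ ∀ m, IsColumn p d J (J - l) m → Q.coeff m = 0 := by
  rw [Finset.mem_Ico] at hl
  have e1 : ((J - l : ℕ) : ℤ) = J - l := by push_cast [hl.2.le]; ring
  have e2 : ((J - 1 : ℕ) : ℤ) = J - 1 := by push_cast [show 1 ≤ J by omega]; ring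
  have e3 : ((p : ℤ) * (((J - 1 : ℕ) : ℤ) + 1 - l) - ((J - 1 : ℕ) : ℤ)) * d =
      (p * (J - l) - (J - 1)) * d := by rw [e2]; ring
  have e4 : ((p : ℤ) * (J + 1 - l) - J) * d = (p * ((J - l) + 1) - J) * d := by ring
  unfold LevelSupport at hQ ⊢
  simp only [IsColumn, e1, e3]
  simp only [e4] at hQ
  constructor
  · rintro h m ⟨-, -, h1, -⟩
    by_contra h2
    exact absurd (h m h2) (not_le.2 h1)
  · intro h m hm
    by_contra h2
    exact hm (h m ⟨by omega, by omega, not_le.1 h2, hQ m hm⟩)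

theorem Phi_injective [Fact p.Prime] [CharP K p] [PerfectRing K p] {J : ℕ} (hJ0 : 0 < J)
    (hJ : J < p)
    (hrow : ∀ P : K[X], PrimeSupport p d J P →
      (∀ n m, IsColumn p d J n m → (fPoly a ^ n * P).coeff (p * m + (p - 1)) = 0) → P = 0) :
    Function.Injective (Phi p a J) := by
  have hp := (Fact.out : p.Prime).pos
  rintro ⟨ω₁, h₁⟩ ⟨ω₂, h₂⟩ h
  obtain ⟨P, hP, rfl⟩ := (mem_HPrime_iff hp _).1 h₁
  obtain ⟨Q, hQ, rfl⟩ := (mem_HPrime_iff hp _).1 h₂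
  suffices hPQ : P - Q = 0 by rw [Subtype.mk.injEq, sub_eq_zero.1 hPQ]
  refine hrow _ (fun m hm => ?_) fun n m hnm => ?_
  · by_cases h : P.coeff m = 0
    · exact hQ m fun h' => hm (by rw [coeff_sub, h, h', sub_zero])
    · exact hP m h
  · obtain ⟨hn, hnJ, -, -⟩ := id hnm
    have hl : J - n ∈ Finset.Ico 1 J := Finset.mem_Ico.2 ⟨by omega, by omega⟩
    have h3 := congrFun h ⟨J - n, hl⟩
    rw [Phi, Phi, Submodule.Quotient.eq, Submodule.submoduleOf, Submodule.mem_comap,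
      Submodule.subtype_apply, Submodule.coe_sub,
      cartierComponents_polyDiff hJ0 hJ hP, cartierComponents_polyDiff hJ0 hJ hQ,
      ← polyDiff_sub, mem_HLevel_iff hp (by simp only; omega)] at h3
    obtain ⟨R, hR, hR'⟩ := h3
    rw [← polyDiff_injective (by simp only; omega) (by simp only; omega) hR'] at hR
    have h5 : LevelSupport p d (J - n) J (cartierPoly p (fPoly a) J (J - n) P -
        cartierPoly p (fPoly a) J (J - n) Q) := by
      have hP' := levelSupport_cartierPoly (a := a) hP hl
      have hQ' := levelSupport_cartierPoly (a := a) hQ hl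
      intro m hm
      by_cases h : (cartierPoly p (fPoly a) J (J - n) P).coeff m = 0
      · exact hQ' m fun h' => hm (by rw [coeff_sub, h, h', sub_zero])
      · exact hP' m h
    have h4 := (levelSupport_pred_iff hl h5).1 hR m (by rwa [show J - (J - n) = n by omega])
    rw [coeff_sub, coeff_cartierPoly, coeff_cartierPoly, ← mul_sub, ← map_sub, ← mul_sub,
      show J - (J - n) = n by omega, ← coeff_sub, ← mul_sub] at h4
    rcases mul_eq_zero.1 h4 with h6 | h6
    · exact absurd h6 (choose_cast_ne_zero (p := p) (by omega) (by omega))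
    · rw [EmbeddingLike.map_eq_zero_iff] at h6
      simpa using h6

theorem Phi_surjective [Fact p.Prime] [CharP K p] [PerfectRing K p] {J : ℕ} (hJ0 : 0 < J)
    (hJ : J < p)
    (hcol : ∀ v : ℕ → ℕ → K, ∃ P : K[X], PrimeSupport p d J P ∧
      ∀ n m, IsColumn p d J n m → (fPoly a ^ n * P).coeff (p * m + (p - 1)) = v n m) :
    Function.Surjective (Phi p a J) := by
  have hp := (Fact.out : p.Prime).pos
  intro τ
  choose η hη using fun l => Submodule.Quotient.mk_surjective _ (τ l)
  have hR : ∀ l : ℕ, ∃ R : K[X], ∀ hl : l ∈ Finset.Ico 1 J,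
      LevelSupport p d l J R ∧ (η ⟨l, hl⟩ : Diff p a) = polyDiff p a l R := by
    intro l
    by_cases hl : l ∈ Finset.Ico 1 J
    · obtain ⟨Q, hQ⟩ := (mem_HLevel_iff hp (Finset.mem_Ico.1 hl).2.le _).1 (η ⟨l, hl⟩).2
      exact ⟨Q, fun _ => hQ⟩
    · exact ⟨0, fun h => absurd h hl⟩
  choose R hR using hR
  -- The prescribed values undo the sign, the binomial factor and the `p`-th root in
  -- `coeff_cartierPoly`.
  obtain ⟨P, hP, hv⟩ := hcol fun n m =>
    (-1) ^ n * ((R (J - n)).coeff m / ((J - 1).choose (J - n - 1) : K)) ^ p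
  refine ⟨⟨polyDiff p a J P, (mem_HPrime_iff hp _).2 ⟨P, hP, rfl⟩⟩, ?_⟩
  funext l
  obtain ⟨l, hl⟩ := l
  have hl' := Finset.mem_Ico.1 hl
  rw [← hη, Phi, Submodule.Quotient.eq, Submodule.submoduleOf, Submodule.mem_comap,
      Submodule.subtype_apply, Submodule.coe_sub,
      cartierComponents_polyDiff hJ0 hJ hP, (hR l hl).2, ← polyDiff_sub,
      mem_HLevel_iff hp (by simp only; omega)]
  refine ⟨_, ?_, rfl⟩
  rw [levelSupport_pred_iff hl]
  · intro m hm
    have h1 := hv _ _ hm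
    rw [show J - (J - l) = l by omega] at h1
    rw [coeff_sub, coeff_cartierPoly, h1, ← mul_assoc, ← pow_add, Even.neg_one_pow ⟨_, rfl⟩,
      one_mul, ← frobenius_def, ← coe_frobeniusEquiv, RingEquiv.symm_apply_apply,
      mul_div_cancel₀ _ (choose_cast_ne_zero (p := p) (by omega) (by simp only; omega)), sub_self]
  · have hP' := levelSupport_cartierPoly (a := a) hP hl
    have hQ' := (hR l hl).1
    intro m hm
    by_cases h : (cartierPoly p (fPoly a) J l P).coeff m = 0
    · exact hQ' m fun h' => hm (by rw [coeff_sub, h, h', sub_zero])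
    · exact hP' m h

end FunctionField

/-! ### A square minor and its nonvanishing at a special polynomial. -/

section GenericRank

/-- A determinant over `F[T]` is nonzero if, up to scaling rows and columns by powers of `T`, the
matrix is congruent modulo `T` to an invertible diagonal matrix. -/
theorem det_ne_zero_of_scaled {F ι : Type*} [Field F] [Fintype ι] [DecidableEq ι]
    (A : Matrix ι ι F[X]) (r c : ι → ℕ) (B : ℕ) (κ : ι → F) (hκ : ∀ i, κ i ≠ 0)
    (h : ∀ i j, ∃ w : F[X],
      X ^ r i * A i j * X ^ c j = X ^ B * ((if i = j then C (κ j) else 0) + X * w)) :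
    A.det ≠ 0 := by
  choose w hw using h
  let N : Matrix ι ι F[X] := Matrix.of fun i j => (if i = j then C (κ j) else 0) + X * w i j
  have h1 : Matrix.diagonal (fun i => (X : F[X]) ^ r i) * A * Matrix.diagonal (fun j => X ^ c j) =
      (X : F[X]) ^ B • N := by
    ext i j : 2
    rw [Matrix.mul_diagonal, Matrix.diagonal_mul, hw, Matrix.smul_apply, smul_eq_mul]
    rfl
  have h2 : (evalRingHom (0 : F)).mapMatrix N = Matrix.diagonal κ := by
    ext i j
    simp only [N, RingHom.mapMatrix_apply, Matrix.map_apply, Matrix.of_apply, Matrix.diagonal_apply]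
    split_ifs with hij
    · simp [hij]
    · simp
  have h3 : N.det ≠ 0 := by
    intro h0
    have h4 := RingHom.map_det (evalRingHom (0 : F)) N
    rw [h0, map_zero, h2, Matrix.det_diagonal] at h4
    exact Finset.prod_ne_zero_iff.2 (fun i _ => hκ i) h4.symm
  intro h0
  have h4 := congrArg Matrix.det h1
  rw [Matrix.det_mul, Matrix.det_mul, h0, mul_zero, zero_mul, Matrix.det_smul] at h4
  exact mul_ne_zero (pow_ne_zero _ (pow_ne_zero _ X_ne_zero)) h3 h4.symm

/-- The polynomial with given coefficients. -/
noncomputable def coeffPoly {R : Type*} [CommSemiring R] {d : ℕ} (a : Fin (d + 1) → R) : R[X] :=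
  ∑ i : Fin (d + 1), C (a i) * X ^ (i : ℕ)

theorem map_coeffPoly {R S : Type*} [CommSemiring R] [CommSemiring S] (φ : R →+* S) {d : ℕ}
    (a : Fin (d + 1) → R) : (coeffPoly a).map φ = coeffPoly fun i => φ (a i) := by
  simp [coeffPoly, Polynomial.map_sum]

/-- The index set of a square submatrix of the matrix of the linear map underlying `Φ_J`: it
consists of triples `(i, n, m)` where the row `i` is matched to the column `(n, m)`. -/
def IsIndex (p d J : ℕ) (t : ℕ × ℕ × ℕ) : Prop :=
  0 < t.1 ∧ p * t.1 < (p - J) * d ∧ 0 < t.2.1 ∧ t.2.1 < J ∧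
    (p * t.2.2 = t.1 + t.2.1 * d ∨
      (p * t.2.2 + t.1 = t.2.1 * d ∧ t.2.1 ≤ p - J ∧ p * t.1 < (J - 1) * d))

open Classical in
/-- The set of all triples satisfying `IsIndex`. -/
noncomputable def indexSet (p d J : ℕ) : Finset (ℕ × ℕ × ℕ) :=
  (Finset.range d ×ˢ Finset.range J ×ˢ Finset.range (d + J * d)).filter (IsIndex p d J)

theorem mem_indexSet {p d J : ℕ} {t : ℕ × ℕ × ℕ} :
    t ∈ indexSet p d J ↔ IsIndex p d J t := by
  classical
  rw [indexSet, Finset.mem_filter, and_iff_right_iff_imp]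
  rintro ⟨h1, h2, h3, h4, h5⟩
  have hp : 0 < p := by
    rcases Nat.eq_zero_or_pos p with rfl | h
    · simp at h2
    · exact h
  have h6 : t.1 < d := by
    refine lt_of_mul_lt_mul_left (h2.trans_le ?_) (Nat.zero_le p)
    exact Nat.mul_le_mul_right d (Nat.sub_le _ _)
  have h7 : t.2.2 ≤ p * t.2.2 := Nat.le_mul_of_pos_left _ hp
  have h8 : t.2.1 * d ≤ J * d := Nat.mul_le_mul_right d h4.le
  simp only [Finset.mem_product, Finset.mem_range]
  refine ⟨h6, h4, ?_⟩
  rcases h5 with h5 | ⟨h5, -, -⟩ <;> omega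

theorem eq_of_dvd_mul {p d n n' : ℕ} (hp : p.Prime) (hpd : ¬ p ∣ d) (hn : n < p) (hn' : n' < p)
    (h : (p : ℤ) ∣ ((n : ℤ) - n') * d) : n = n' := by
  have hp' : Prime (p : ℤ) := Nat.prime_iff_prime_int.1 hp
  rcases hp'.dvd_or_dvd h with h1 | h1
  · have := Int.eq_zero_of_abs_lt_dvd h1 (by rw [abs_lt]; constructor <;> omega)
    omega
  · exact absurd (Int.natCast_dvd_natCast.1 h1) hpd

/-- Within either type of matching, `i` modulo `p` determines `n`, as `d` is invertible. The two
types cannot share a row: that would give `p ∣ n + n'`, whereas `0 < n + n' < J + (p - J)`. -/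
theorem IsIndex.ext {p d J : ℕ} (hp : p.Prime) (hpd : ¬ p ∣ d) (hJ : J < p) {t t' : ℕ × ℕ × ℕ}
    (ht : IsIndex p d J t) (ht' : IsIndex p d J t') (h : t.1 = t'.1) : t = t' := by
  obtain ⟨i, n, m⟩ := t
  obtain ⟨i', n', m'⟩ := t'
  obtain ⟨h1, h2, h3, h4, h5⟩ := ht
  obtain ⟨-, -, h3', h4', h5'⟩ := ht'
  simp only at *
  subst h
  have hmixed : ∀ {u v w x : ℕ}, 0 < u → u < J → v ≤ p - J → p * w = i + u * d →
      p * x + i = v * d → False := by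
    intro u v w x hu huJ hv e1 e2
    have h6 : p ∣ (u + v) * d := ⟨w + x, by rw [mul_add, e1, add_mul, ← e2]; ring⟩
    rcases hp.dvd_mul.1 h6 with h7 | h7
    · exact absurd (Nat.le_of_dvd (by omega) h7) (by omega)
    · exact hpd h7
  have hmm : n = n' → p * m = p * m' → (i, n, m) = (i, n', m') := by
    intro e1 e2
    rw [e1, Nat.eq_of_mul_eq_mul_left hp.pos e2]
  rcases h5 with h5 | ⟨h5, h6, -⟩ <;> rcases h5' with h5' | ⟨h5', h6', -⟩
  · have hn : n = n' := by
      refine eq_of_dvd_mul hp hpd (by omega) (by omega) ⟨m - m', ?_⟩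
      zify at h5 h5'
      linear_combination h5' - h5
    exact hmm hn (by rw [h5, h5', hn])
  · exact (hmixed h3 h4 h6' h5 h5').elim
  · exact (hmixed h3' h4' h6 h5' h5).elim
  · have hn : n = n' := by
      refine eq_of_dvd_mul hp hpd (by omega) (by omega) ⟨m - m', ?_⟩
      zify at h5 h5'
      linear_combination h5' - h5
    refine hmm hn ?_
    rw [← hn] at h5'
    omega

/-- The square submatrix indexed by `indexSet`. -/
noncomputable def levelMatrix {R : Type*} [CommSemiring R] (p d J : ℕ) (f : R[X]) :
    Matrix (indexSet p d J) (indexSet p d J) R :=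
  Matrix.of fun t s => (X ^ t.1.1 * f ^ s.1.2.1).coeff (p * s.1.2.2)

theorem map_levelMatrix {R S : Type*} [CommSemiring R] [CommSemiring S] (φ : R →+* S) (p d J : ℕ)
    (f : R[X]) : φ.mapMatrix (levelMatrix p d J f) = levelMatrix p d J (f.map φ) := by
  ext t s
  simp only [levelMatrix, RingHom.mapMatrix_apply, Matrix.map_apply, Matrix.of_apply]
  rw [← coeff_map, Polynomial.map_mul, Polynomial.map_pow, Polynomial.map_pow, map_X]

/-- The specialisation `x^d + ∑_{e=1}^d T^{10d²-e²} x^{d-e}` of the generic polynomial. -/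
noncomputable def specialCoeff (F : Type*) [Field F] (d : ℕ) (i : Fin (d + 1)) : F[X] :=
  if (i : ℕ) = d then 1 else X ^ (10 * d ^ 2 - (d - i) ^ 2)

/-- The lower order part of the special polynomial. -/
noncomputable def specialTail (F : Type*) [Field F] (d : ℕ) : F[X][X] :=
  ∑ j ∈ Finset.range d, C (X ^ (10 * d ^ 2 - (d - j) ^ 2)) * X ^ j

theorem coeffPoly_special (F : Type*) [Field F] (d : ℕ) :
    coeffPoly (specialCoeff F d) = X ^ d + specialTail F d := by
  have h1 : ∀ j : Fin d, specialCoeff F d j.castSucc = X ^ (10 * d ^ 2 - (d - j) ^ 2) := by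
    intro j
    rw [specialCoeff, Fin.val_castSucc, if_neg j.2.ne]
  have h2 : specialCoeff F d (Fin.last d) = 1 := by rw [specialCoeff, Fin.val_last, if_pos rfl]
  rw [coeffPoly, Fin.sum_univ_castSucc, specialTail, Finset.sum_range, h2, C_1, one_mul,
    Fin.val_last, add_comm]
  simp only [h1, Fin.val_castSucc]

theorem coeff_specialTail (F : Type*) [Field F] (d j : ℕ) :
    (specialTail F d).coeff j = if j < d then X ^ (10 * d ^ 2 - (d - j) ^ 2) else 0 := by
  simp only [specialTail, finsetSum_coeff, coeff_C_mul_X_pow]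
  simp

/-- Expand to first order in the tail. Every tail coefficient is divisible by `T^{9d²}` because `e ≤
d`, so quadratic and higher terms are divisible by `T^{18d²}`. -/
theorem coeff_pow_special (F : Type*) [Field F] (d i n M : ℕ) (hn : 0 < n) : ∃ w : F[X],
    (X ^ i * coeffPoly (specialCoeff F d) ^ n).coeff M =
      (if M = i + n * d then 1 else 0) +
      (n : F[X]) * (if M < i + n * d ∧ i + n * d ≤ M + d then
        X ^ (10 * d ^ 2 - (i + n * d - M) ^ 2) else 0) + X ^ (18 * d ^ 2) * w := by
  obtain ⟨n, rfl⟩ : ∃ n', n = n' + 1 := ⟨n - 1, by omega⟩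
  have htail : ∃ h : F[X][X], specialTail F d = C (X ^ (9 * d ^ 2)) * h := by
    refine ⟨∑ j ∈ Finset.range d, C (X ^ (d ^ 2 - (d - j) ^ 2)) * X ^ j, ?_⟩
    rw [specialTail, Finset.mul_sum]
    refine Finset.sum_congr rfl fun j _ => ?_
    rw [← mul_assoc, ← C_mul, ← pow_add]
    have : (d - j) ^ 2 ≤ d ^ 2 := Nat.pow_le_pow_left (Nat.sub_le _ _) 2
    congr 3
    omega
  obtain ⟨h, hh⟩ := htail
  obtain ⟨z, hz⟩ := Polynomial.binomExpansion (X ^ (n + 1) : F[X][X][X]) (X ^ d) (specialTail F d)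
  simp only [eval_pow, eval_X, derivative_X_pow, eval_mul, eval_C, Nat.add_sub_cancel] at hz
  refine ⟨(X ^ i * (z * h ^ 2)).coeff M, ?_⟩
  have e1 : (X : F[X][X]) ^ i * coeffPoly (specialCoeff F d) ^ (n + 1) =
      X ^ (i + (n + 1) * d) + C ((n + 1 : ℕ) : F[X]) * (X ^ (i + n * d) * specialTail F d) +
        C (X ^ (18 * d ^ 2)) * (X ^ i * (z * h ^ 2)) := by
    have e2 : z * specialTail F d ^ 2 = C (X ^ (18 * d ^ 2)) * (z * h ^ 2) := by
      rw [hh, mul_pow, ← C_pow, ← pow_mul, show 9 * d ^ 2 * 2 = 18 * d ^ 2 by ring]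
      ring
    rw [coeffPoly_special, hz, e2]
    simp only [Nat.cast_add, Nat.cast_one, map_add, map_natCast, C_1]
    ring
  rw [e1, coeff_add, coeff_add, coeff_C_mul, coeff_C_mul, coeff_X_pow, coeff_X_pow_mul',
    coeff_specialTail]
  congr 3
  have h1 : (n + 1) * d = n * d + d := by ring
  rw [h1]
  split_ifs with h2 h3 h4 h4 h4
  · congr 3; omega
  · omega
  · omega
  · rfl
  · omega
  · rfl

/-- Let `i₀` be the row matched to a column. If `pm = nd + i₀`, the diagonal entry is the leading
coefficient `1`. If `pm = nd - i₀`, the main term in row `i` is `n T^{10d²-(i+i₀)²}`, which the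
scaling turns into `n T^{10d²+(i-i₀)²}`; the exponent is minimal exactly at `i = i₀`, and `n` is
nonzero in `F`. -/
theorem det_levelMatrix_special_ne_zero (F : Type*) [Field F] {p d J : ℕ} [Fact p.Prime]
    [CharP F p] (hpd : ¬ p ∣ d) (hJ0 : 0 < J) (hJ : J < p) [DecidableEq (indexSet p d J)] :
    (levelMatrix p d J (coeffPoly (specialCoeff F d))).det ≠ 0 := by
  classical
  have hp : p.Prime := Fact.out
  let isS : indexSet p d J → Prop := fun s => p * s.1.2.2 = s.1.1 + s.1.2.1 * d
  have hlt : ∀ s : indexSet p d J, s.1.1 < d := by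
    intro s
    have := (mem_indexSet.1 s.2).2.1
    exact lt_of_mul_lt_mul_left (this.trans_le (Nat.mul_le_mul_right d (Nat.sub_le _ _)))
      (Nat.zero_le p)
  refine det_ne_zero_of_scaled _ (fun t => 2 * t.1.1 ^ 2)
    (fun s => if isS s then 10 * d ^ 2 - 2 * s.1.1 ^ 2 else 2 * s.1.1 ^ 2) (10 * d ^ 2)
    (fun s => if isS s then 1 else (s.1.2.1 : F)) ?_ ?_
  · intro s
    obtain ⟨-, -, h1, h2, -⟩ := mem_indexSet.1 s.2
    split_ifs
    · exact one_ne_zero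
    · rw [Ne, CharP.cast_eq_zero_iff F p]
      exact fun h => absurd (Nat.le_of_dvd h1 h) (by omega)
  · intro t s
    have hts : t = s ↔ t.1.1 = s.1.1 := ⟨fun h => by rw [h], fun h =>
      Subtype.ext ((mem_indexSet.1 t.2).ext hp hpd hJ (mem_indexSet.1 s.2) h)⟩
    have hi := hlt t
    have hi0 := hlt s
    obtain ⟨-, ht, -⟩ := mem_indexSet.1 t.2
    obtain ⟨hs0, hs1, hs2, hs3, hs⟩ := mem_indexSet.1 s.2
    obtain ⟨w, hw⟩ := coeff_pow_special F d t.1.1 s.1.2.1 (p * s.1.2.2) hs2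
    simp only [levelMatrix, Matrix.of_apply]
    rw [hw]
    generalize t.1.1 = i at *
    have hii : i ^ 2 ≤ d ^ 2 := Nat.pow_le_pow_left hi.le 2
    have hd1 : 0 < d ^ 2 := pow_pos (by omega) 2
    by_cases hS : isS s
    · simp only [if_pos hS]
      rw [show p * s.1.2.2 = s.1.1 + s.1.2.1 * d from hS]
      generalize s.1.2.1 = n at *
      generalize s.1.1 = i0 at *
      have hii0 : i0 ^ 2 ≤ d ^ 2 := Nat.pow_le_pow_left hi0.le 2
      have e0 : ∀ A : F[X], X ^ (2 * i ^ 2) * A * X ^ (10 * d ^ 2 - 2 * i0 ^ 2) =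
          X ^ (2 * i ^ 2 + (10 * d ^ 2 - 2 * i0 ^ 2)) * A := by
        intro A; rw [pow_add]; ring
      rw [e0, mul_add (X ^ (2 * i ^ 2 + (10 * d ^ 2 - 2 * i0 ^ 2)) : F[X]), ← mul_assoc _ _ w,
        ← pow_add]
      obtain ⟨w', e1⟩ : ∃ w',
          (X : F[X]) ^ (2 * i ^ 2 + (10 * d ^ 2 - 2 * i0 ^ 2) + 18 * d ^ 2) * w =
          X ^ (10 * d ^ 2) * (X * w') := by
        refine ⟨X ^ (2 * i ^ 2 + 18 * d ^ 2 - 2 * i0 ^ 2 - 1) * w, ?_⟩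
        rw [← mul_assoc, ← mul_assoc, ← pow_succ, ← pow_add]
        congr 2; omega
      rw [e1]
      by_cases h : i = i0
      · rw [if_pos (hts.2 h), if_pos (show i0 + n * d = i + n * d by rw [h]), if_neg (by omega), h]
        refine ⟨w', ?_⟩
        rw [mul_zero, add_zero, mul_one, mul_add,
          show 2 * i0 ^ 2 + (10 * d ^ 2 - 2 * i0 ^ 2) = 10 * d ^ 2 by omega, C_1, mul_one]
      · rw [if_neg (mt hts.1 h), if_neg (show ¬ i0 + n * d = i + n * d by omega)]
        simp only [zero_add]
        split_ifs with h2
        · have h3 : (i + n * d - (i0 + n * d)) ^ 2 ≤ d ^ 2 := Nat.pow_le_pow_left (by omega) 2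
          generalize (i + n * d - (i0 + n * d)) ^ 2 = E at *
          refine ⟨(n : F[X]) * X ^ (2 * i ^ 2 + (10 * d ^ 2 - 2 * i0 ^ 2) - E - 1) + w', ?_⟩
          rw [mul_add, mul_add]
          congr 1
          rw [mul_left_comm, ← pow_add, mul_left_comm X, mul_left_comm _ (n : F[X]), ← pow_succ',
            ← pow_add]
          congr 2; omega
        · exact ⟨w', by rw [mul_zero, mul_zero, zero_add]⟩
    · rcases hs with hs | ⟨hs, hs4, hs5⟩
      · exact absurd hs hS
      simp only [if_neg hS]
      -- From `pi < (p-J)d` and `pi₀ < (J-1)d`; thus `x^{d-(i+i₀)}` really occurs in the tail.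
      have hsum : i + s.1.1 < d := by
        have h1 : p * (i + s.1.1) < p * d := by
          have : (p - J) * d + (J - 1) * d ≤ p * d := by
            rw [← add_mul]; exact Nat.mul_le_mul_right d (by omega)
          rw [mul_add]; omega
        exact lt_of_mul_lt_mul_left h1 (Nat.zero_le p)
      generalize p * s.1.2.2 = M at *
      generalize s.1.2.1 = n at *
      generalize s.1.1 = i0 at *
      have e0 : ∀ A : F[X], X ^ (2 * i ^ 2) * A * X ^ (2 * i0 ^ 2) =
          X ^ (2 * i ^ 2 + 2 * i0 ^ 2) * A := by
        intro A; rw [pow_add]; ring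
      rw [e0, mul_add (X ^ (2 * i ^ 2 + 2 * i0 ^ 2) : F[X]), ← mul_assoc _ _ w, ← pow_add]
      obtain ⟨w', e1⟩ : ∃ w',
          (X : F[X]) ^ (2 * i ^ 2 + 2 * i0 ^ 2 + 18 * d ^ 2) * w =
          X ^ (10 * d ^ 2) * (X * w') := by
        refine ⟨X ^ (2 * i ^ 2 + 2 * i0 ^ 2 + 8 * d ^ 2 - 1) * w, ?_⟩
        rw [← mul_assoc, ← mul_assoc, ← pow_succ, ← pow_add]
        congr 2; omega
      rw [e1, if_neg (by omega), zero_add, if_pos (by omega),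
        show i + n * d - M = i + i0 by omega]
      have h3 : (i + i0) ^ 2 ≤ d ^ 2 := Nat.pow_le_pow_left hsum.le 2
      by_cases h : i = i0
      · rw [if_pos (hts.2 h)]
        refine ⟨w', ?_⟩
        rw [mul_add _ (C (n : F))]
        congr 1
        rw [mul_left_comm, ← pow_add, map_natCast, mul_comm]
        congr 2
        subst h
        have : (i + i) ^ 2 = 2 * i ^ 2 + 2 * i ^ 2 := by ring
        omega
      · rw [if_neg (mt hts.1 h)]
        have h4 : 2 * i ^ 2 + 2 * i0 ^ 2 ≥ (i + i0) ^ 2 + 1 := by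
          zify
          have : ((i : ℤ) - i0) ^ 2 > 0 := by
            have : (i : ℤ) - i0 ≠ 0 := by omega
            positivity
          nlinarith
        generalize (i + i0) ^ 2 = E at *
        refine ⟨(n : F[X]) * X ^ (2 * i ^ 2 + 2 * i0 ^ 2 - E - 1) + w', ?_⟩
        rw [zero_add, mul_add, mul_add]
        congr 1
        rw [mul_left_comm, ← pow_add, mul_left_comm X, mul_left_comm _ (n : F[X]), ← pow_succ',
          ← pow_add]
        congr 2; omega

/-! ### Which rows and columns the minor contains. -/

theorem IsIndex.not_dvd {p d J : ℕ} (hp : p.Prime) (hpd : ¬ p ∣ d) (hJ : J < p) {t : ℕ × ℕ × ℕ}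
    (ht : IsIndex p d J t) : ¬ p ∣ t.1 := by
  obtain ⟨-, -, h3, h4, h5⟩ := ht
  intro h
  have h6 : p ∣ t.2.1 * d := by
    rcases h5 with h5 | ⟨h5, -⟩
    · exact (Nat.dvd_add_right h).1 (h5 ▸ dvd_mul_right _ _)
    · rw [← h5]; exact dvd_add (dvd_mul_right _ _) h
  rcases hp.dvd_mul.1 h6 with h7 | h7
  · exact absurd (Nat.le_of_dvd h3 h7) (by omega)
  · exact hpd h7

/-- The bound `pi < (p-J)d` gives the upper end of the window when `pm = nd + i`, and `pi < (J-1)d`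
gives the lower end when `pm = nd - i`. The third entry of a triple is `m + 1` in the indexing of
`IsColumn`. -/
theorem IsIndex.isColumn {p d J : ℕ} (hJ : J < p) {t : ℕ × ℕ × ℕ} (ht : IsIndex p d J t) :
    0 < t.2.2 ∧ IsColumn p d J t.2.1 (t.2.2 - 1) := by
  obtain ⟨i, n, m⟩ := t
  obtain ⟨h1, h2, h3, h4, h5⟩ := ht
  simp only at *
  have hp0 : 0 < p := by omega
  have hid : i < d :=
    lt_of_mul_lt_mul_left (h2.trans_le (Nat.mul_le_mul_right d (Nat.sub_le _ _))) (Nat.zero_le p)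
  have hnd : d ≤ n * d := Nat.le_mul_of_pos_left _ h3
  have hm : 0 < m := by
    rcases Nat.eq_zero_or_pos m with rfl | h
    · rw [mul_zero] at h5
      rcases h5 with h5 | ⟨h5, -⟩ <;> omega
    · exact h
  refine ⟨hm, h3, h4, ?_⟩
  rw [show (((m - 1 : ℕ) : ℤ) + 1) = m by omega]
  have hc1 : ((p - J : ℕ) : ℤ) = p - J := by omega
  have hc2 : ((J - 1 : ℕ) : ℤ) = J - 1 := by omega
  have h2' : (p : ℤ) * i < (p - J) * d := by rw [← hc1]; exact_mod_cast h2
  have hi : (0 : ℤ) < p * i := by positivity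
  have hJd : (0 : ℤ) ≤ (J - 1) * d := by rw [← hc2]; positivity
  have hpJd : (0 : ℤ) ≤ (p - J) * d := by rw [← hc1]; positivity
  rcases h5 with h5 | ⟨h5, -, h6⟩
  · have e : (p : ℤ) * m = i + n * d := by exact_mod_cast h5
    have e2 : (p : ℤ) ^ 2 * m = p * i + p * n * d := by linear_combination (p : ℤ) * e
    rw [e2]
    constructor <;> nlinarith
  · have h6' : (p : ℤ) * i < (J - 1) * d := by rw [← hc2]; exact_mod_cast h6
    have e : (p : ℤ) * m + i = n * d := by exact_mod_cast h5
    have e2 : (p : ℤ) ^ 2 * m = - (p * i) + p * n * d := by linear_combination (p : ℤ) * e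
    rw [e2]
    constructor <;> nlinarith

/-- For `J ≥ (p+1)/2` every row occurs in the square submatrix. -/
theorem exists_isIndex_row {p d J : ℕ} (hp : p.Prime) (hpd : ¬ p ∣ d) (hJ : J < p)
    (hJ2 : p + 1 ≤ 2 * J) {i : ℕ} (hi0 : 0 < i) (hpi : ¬ p ∣ i) (hi : p * i < (p - J) * d) :
    ∃ t, IsIndex p d J t ∧ t.1 = i := by
  have := Fact.mk hp
  have hd : (d : ZMod p) ≠ 0 := by rwa [Ne, ZMod.natCast_eq_zero_iff]
  have hi' : (i : ZMod p) ≠ 0 := by rwa [Ne, ZMod.natCast_eq_zero_iff]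
  -- The residue making `i + nd` divisible by `p`. If it is at least `J`, then `p - n ≤ p - J < J`
  -- serves in the other type of matching.
  set n := (-(i : ZMod p) / d).val with hn
  have hnp : n < p := ZMod.val_lt _
  have hn0 : 0 < n := by
    rw [hn, ZMod.val_pos]
    exact div_ne_zero (neg_ne_zero.2 hi') hd
  have hdvd : p ∣ i + n * d := by
    rw [← ZMod.natCast_eq_zero_iff, Nat.cast_add, Nat.cast_mul, hn, ZMod.natCast_zmod_val,
      div_mul_cancel₀ _ hd, add_neg_cancel]
  have hid : i < d :=
    lt_of_mul_lt_mul_left (hi.trans_le (Nat.mul_le_mul_right d (Nat.sub_le _ _))) (Nat.zero_le p)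
  by_cases hnJ : n < J
  · obtain ⟨m, hm⟩ := hdvd
    exact ⟨(i, n, m), ⟨hi0, hi, hn0, hnJ, Or.inl hm.symm⟩, rfl⟩
  · have h1 : (p - n) * d + n * d = p * d := by rw [← add_mul, Nat.sub_add_cancel hnp.le]
    have h2 : d ≤ (p - n) * d := Nat.le_mul_of_pos_left _ (by omega)
    have h3 : p ∣ (p - n) * d - i := by
      rw [show (p - n) * d - i = p * d - (i + n * d) by omega]
      exact Nat.dvd_sub (dvd_mul_right _ _) hdvd
    obtain ⟨m, hm⟩ := h3
    refine ⟨(i, p - n, m), ⟨hi0, hi, by simp only; omega, by simp only; omega,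
      Or.inr ⟨by simp only; omega, by simp only; omega, ?_⟩⟩, rfl⟩
    exact hi.trans_le (Nat.mul_le_mul_right d (by omega))

/-- For `J ≤ (p+1)/2` every column occurs in the square submatrix. -/
theorem exists_isIndex_column {p d J : ℕ} (hp : p.Prime) (hpd : ¬ p ∣ d) (hJ : J < p)
    (hJ2 : 2 * J ≤ p + 1) {n m : ℕ} (h : IsColumn p d J n m) :
    ∃ i, IsIndex p d J (i, n, m + 1) := by
  obtain ⟨hn0, hnJ, h1, h2⟩ := h
  have hc1 : ((p - J : ℕ) : ℤ) = p - J := by omega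
  have hc2 : ((J - 1 : ℕ) : ℤ) = J - 1 := by omega
  have hp0 := hp.pos
  rcases lt_trichotomy (p * (m + 1)) (n * d) with h3 | h3 | h3
  · obtain ⟨i, hi⟩ := Nat.exists_eq_add_of_le h3.le
    have e : (n : ℤ) * d = p * (m + 1) + i := by exact_mod_cast hi
    have h4 : p * i < (J - 1) * d := by
      zify
      rw [hc2]
      have : (p : ℤ) * i = p * (n * d) - p ^ 2 * (m + 1) := by linear_combination -(p : ℤ) * e
      rw [this]; linarith
    refine ⟨i, by simp only; omega, ?_, hn0, hnJ, Or.inr ⟨hi.symm, by simp only; omega, h4⟩⟩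
    exact h4.trans_le (Nat.mul_le_mul_right d (by omega))
  · exfalso
    have h4 : p ∣ n * d := ⟨_, h3.symm⟩
    rcases hp.dvd_mul.1 h4 with h5 | h5
    · exact absurd (Nat.le_of_dvd hn0 h5) (by omega)
    · exact hpd h5
  · obtain ⟨i, hi⟩ := Nat.exists_eq_add_of_le h3.le
    have e : (p : ℤ) * (m + 1) = n * d + i := by exact_mod_cast hi
    have h4 : p * i ≤ (p - J) * d := by
      zify
      rw [hc1]
      have : (p : ℤ) * i = p ^ 2 * (m + 1) - p * (n * d) := by linear_combination -(p : ℤ) * e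
      rw [this]; linarith
    -- The window of `H(l,J)` is closed but that of `′H^J` is open; equality is impossible since `p`
    -- divides neither `p - J` nor `d`.
    have h5 : p * i ≠ (p - J) * d := by
      intro h5
      rcases hp.dvd_mul.1 ⟨i, h5.symm⟩ with h6 | h6
      · exact absurd (Nat.le_of_dvd (by omega) h6) (by omega)
      · exact hpd h6
    exact ⟨i, by simp only; omega, lt_of_le_of_ne h4 h5, hn0, hnJ,
      Or.inl (by simp only; omega)⟩

theorem coeff_mul_eq_vecMul {K : Type*} [CommRing K] {p d J : ℕ} (hp : 0 < p) (f P : K[X])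
    (c : indexSet p d J → K) (hP : X * P = ∑ t, C (c t) * X ^ t.1.1) (s : indexSet p d J)
    (hs : 0 < s.1.2.2) :
    (f ^ s.1.2.1 * P).coeff (p * (s.1.2.2 - 1) + (p - 1)) =
      Matrix.vecMul c (levelMatrix p d J f) s := by
  obtain ⟨m, hm⟩ : ∃ m, s.1.2.2 = m + 1 := ⟨s.1.2.2 - 1, by omega⟩
  have h1 : p * (m + 1) = p * m + (p - 1) + 1 := by rw [mul_add]; omega
  simp only [Matrix.vecMul, dotProduct, levelMatrix, Matrix.of_apply]
  rw [hm, Nat.add_sub_cancel, h1, ← coeff_X_mul, mul_left_comm, hP, Finset.mul_sum,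
    finsetSum_coeff]
  refine Finset.sum_congr rfl fun t _ => ?_
  rw [mul_left_comm, coeff_C_mul, mul_comm (f ^ _)]

variable {K : Type u} [Field K] {p : ℕ} {d : ℕ} {a : Fin (d + 1) → K}

/-- Every monomial of `P` is a row of the minor, so the vanishing of the minor's columns alone
forces `P = 0`. -/
theorem Phi_injective_of_det_ne_zero [Fact p.Prime] [CharP K p] [PerfectRing K p] {J : ℕ}
    (hpd : ¬ p ∣ d) (hJ : J < p) (hJ2 : p + 1 ≤ 2 * J) [DecidableEq (indexSet p d J)]
    (hdet : (levelMatrix p d J (fPoly a)).det ≠ 0) :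
    Function.Injective (Phi p a J) := by
  have hp : p.Prime := Fact.out
  refine Phi_injective (by omega) hJ fun P hP h => ?_
  have hX : X * P = ∑ t : indexSet p d J, C (P.coeff (t.1.1 - 1)) * X ^ t.1.1 := by
    ext e
    rw [finsetSum_coeff]
    simp only [coeff_C_mul_X_pow]
    rcases e with _ | e
    · rw [coeff_X_mul_zero, Finset.sum_eq_zero]
      intro t _
      rw [if_neg (mem_indexSet.1 t.2).1.ne]
    · rw [coeff_X_mul]
      by_cases he : P.coeff e = 0
      · rw [he, Finset.sum_eq_zero]
        intro t _
        split_ifs with hte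
        · rw [← hte, Nat.add_sub_cancel, he]
        · rfl
      · obtain ⟨h1, h2⟩ := hP e he
        have hc1 : ((p - J : ℕ) : ℤ) = p - J := by omega
        rw [← hc1] at h1
        obtain ⟨t, ht, hte⟩ := exists_isIndex_row hp hpd hJ hJ2 (Nat.succ_pos e) h2
          (by exact_mod_cast h1)
        rw [Finset.sum_eq_single ⟨t, mem_indexSet.2 ht⟩]
        · rw [hte, if_pos rfl, Nat.succ_sub_one]
        · intro s _ hs
          rw [if_neg]
          intro hse
          exact hs (Subtype.ext ((mem_indexSet.1 s.2).ext hp hpd hJ ht (hse.symm.trans hte.symm)))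
        · intro h; exact absurd (Finset.mem_univ _) h
  have hc : (fun t : indexSet p d J => P.coeff (t.1.1 - 1)) = 0 := by
    refine Matrix.eq_zero_of_vecMul_eq_zero hdet ?_
    ext s
    obtain ⟨h1, h2⟩ := (mem_indexSet.1 s.2).isColumn hJ
    rw [← coeff_mul_eq_vecMul hp.pos _ P _ hX s h1, h _ _ h2]
    rfl
  have h0 : X * P = 0 := by
    rw [hX]
    refine Finset.sum_eq_zero fun t _ => ?_
    rw [show P.coeff (t.1.1 - 1) = 0 from congrFun hc t, C_0, zero_mul]
  exact (mul_eq_zero.1 h0).resolve_left X_ne_zero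

/-- Every column lies in the minor, so inverting it solves for `P` using only the matched rows. -/
theorem Phi_surjective_of_det_ne_zero [Fact p.Prime] [CharP K p] [PerfectRing K p] {J : ℕ}
    (hpd : ¬ p ∣ d) (hJ0 : 0 < J) (hJ : J < p) (hJ2 : 2 * J ≤ p + 1)
    [DecidableEq (indexSet p d J)] (hdet : (levelMatrix p d J (fPoly a)).det ≠ 0) :
    Function.Surjective (Phi p a J) := by
  have hp : p.Prime := Fact.out
  refine Phi_surjective hJ0 hJ fun v => ?_
  set A := levelMatrix p d J (fPoly a) with hA
  let w : indexSet p d J → K := fun s => v s.1.2.1 (s.1.2.2 - 1)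
  let c : indexSet p d J → K := Matrix.vecMul w A⁻¹
  have hcA : Matrix.vecMul c A = w := by
    simp only [c]
    rw [Matrix.vecMul_vecMul, Matrix.nonsing_inv_mul _ hdet.isUnit, Matrix.vecMul_one]
  refine ⟨∑ t, C (c t) * X ^ (t.1.1 - 1), fun m hm => ?_, fun n m hnm => ?_⟩
  · rw [finsetSum_coeff] at hm
    obtain ⟨t, -, ht⟩ := Finset.exists_ne_zero_of_sum_ne_zero hm
    rw [coeff_C_mul_X_pow] at ht
    have htm : m = t.1.1 - 1 := by
      by_contra h
      exact ht (if_neg h)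
    have hI := mem_indexSet.1 t.2
    have h0 := hI.1
    have h1 : m + 1 = t.1.1 := by omega
    have hc1 : ((p - J : ℕ) : ℤ) = p - J := by omega
    refine ⟨?_, h1 ▸ hI.not_dvd hp hpd hJ⟩
    rw [← hc1]
    have := hI.2.1
    rw [← h1] at this
    exact_mod_cast this
  · obtain ⟨i, hi⟩ := exists_isIndex_column hp hpd hJ hJ2 hnm
    have := coeff_mul_eq_vecMul hp.pos (fPoly a) (∑ t, C (c t) * X ^ (t.1.1 - 1)) c (by
      rw [Finset.mul_sum]
      refine Finset.sum_congr rfl fun t _ => ?_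
      rw [mul_left_comm, ← pow_succ', Nat.sub_add_cancel (mem_indexSet.1 t.2).1])
      ⟨(i, n, m + 1), mem_indexSet.2 hi⟩ (Nat.succ_pos m)
    simp only [Nat.add_sub_cancel] at this
    rw [this, ← hA, hcA]
    rfl

/-! ### The generic determinant and the open set `U`. -/

open Classical in
/-- The determinant of the square submatrix for the generic polynomial. -/
noncomputable def genericDet (k : Type u) [Field k] (p d J : ℕ) : MvPolynomial (Fin (d + 1)) k :=
  (levelMatrix p d J (coeffPoly MvPolynomial.X)).det

theorem map_genericDet {k S : Type u} [Field k] [CommRing S] [Algebra k S] (b : Fin (d + 1) → S)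
    (J : ℕ) [DecidableEq (indexSet p d J)] :
    MvPolynomial.aeval b (genericDet k p d J) = (levelMatrix p d J (coeffPoly b)).det := by
  let φ : MvPolynomial (Fin (d + 1)) k →+* S := ↑(MvPolynomial.aeval (R := k) b)
  have h : φ (levelMatrix p d J (coeffPoly (MvPolynomial.X (R := k)))).det =
      (φ.mapMatrix (levelMatrix p d J (coeffPoly MvPolynomial.X))).det := RingHom.map_det φ _
  have h2 : φ.mapMatrix (levelMatrix p d J (coeffPoly MvPolynomial.X)) =
      levelMatrix p d J (coeffPoly b) := by
    refine (map_levelMatrix φ p d J _).trans ?_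
    rw [map_coeffPoly]
    simp only [φ, RingHom.coe_coe, MvPolynomial.aeval_X]
  rw [h2] at h
  rw [← h, genericDet]
  congr!

theorem genericDet_ne_zero (k : Type u) [Field k] [Fact p.Prime] [CharP k p] (hpd : ¬ p ∣ d)
    {J : ℕ} (hJ0 : 0 < J) (hJ : J < p) : genericDet k p d J ≠ 0 := by
  classical
  intro h
  have h1 := map_genericDet (k := k) (p := p) (specialCoeff k d) J
  rw [h, map_zero] at h1
  exact det_levelMatrix_special_ne_zero k hpd hJ0 hJ h1.symm

end GenericRank

end ArtinSchreier

theorem theorem2p8 (p : ℕ) (hp : p.Prime) (hp2 : 2 < p)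
    (k : Type u) [Field k] [CharP k p] [PerfectField k]
    (d : ℕ) (hd : 0 < d) (hpd : ¬ p ∣ d) :
    ∃ U : Set (PrimeSpectrum (MvPolynomial (Fin (d + 1)) k)),
      IsOpen U ∧ U.Nonempty ∧ U ⊆ ArtinSchreier.paramSpace k d ∧
      ∀ (K : Type u) [Field K] [Algebra k K] [PerfectField K] (a : Fin (d + 1) → K),
        ArtinSchreier.ratPoint k a ∈ U →
        -- the maps `Φ_J` are well defined: `𝒞` maps `′H^J` into the direct sum of the `H(ℓ,J)`
        (∀ J : ℕ, 1 < J → J < p → ∀ ω ∈ ArtinSchreier.HPrime p a J,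
          ∃! η : (l : Finset.Ico 1 J) → ArtinSchreier.HLevel p a l J,
            ∑ l, (η l : ArtinSchreier.Diff p a) = ArtinSchreier.cartier p a ω) ∧
        (∀ J : ℕ, 1 < J → (J : ℚ) ≤ ((p : ℚ) + 1) / 2 →
          Function.Surjective (ArtinSchreier.Phi p a J)) ∧
        (∀ J : ℕ, ((p : ℚ) + 1) / 2 ≤ (J : ℚ) → J < p →
          Function.Injective (ArtinSchreier.Phi p a J)) := by
  classical
  have := Fact.mk hp
  let D : MvPolynomial (Fin (d + 1)) k :=
    MvPolynomial.X (Fin.last d) * ∏ J ∈ Finset.Ioo 0 p, ArtinSchreier.genericDet k p d J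
  have hD : D ≠ 0 := by
    refine mul_ne_zero (MvPolynomial.X_ne_zero _) (Finset.prod_ne_zero_iff.2 fun J hJ => ?_)
    rw [Finset.mem_Ioo] at hJ
    exact ArtinSchreier.genericDet_ne_zero k hpd hJ.1 hJ.2
  -- The generic point, the zero ideal, witnesses that the open set is nonempty, as `D ≠ 0`.
  refine ⟨PrimeSpectrum.basicOpen D, (PrimeSpectrum.basicOpen D).isOpen,
    ⟨⟨⊥, Ideal.isPrime_bot⟩, ?_⟩, ?_, ?_⟩
  · rw [SetLike.mem_coe, PrimeSpectrum.mem_basicOpen]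
    simpa using hD
  · exact PrimeSpectrum.basicOpen_mul_le_left _ _
  · intro K _ _ _ a ha
    have hK : CharP K p := charP_of_injective_algebraMap (algebraMap k K).injective p
    have hperf : PerfectRing K p := PerfectField.toPerfectRing p
    have hdet : ∀ J, 0 < J → J < p →
        (ArtinSchreier.levelMatrix p d J (ArtinSchreier.fPoly a)).det ≠ 0 := by
      intro J hJ0 hJ h
      refine (PrimeSpectrum.mem_basicOpen _ _).1 ha ?_
      change MvPolynomial.aeval a D = 0
      have h1 : MvPolynomial.aeval a (ArtinSchreier.genericDet k p d J) = 0 := by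
        rw [ArtinSchreier.map_genericDet, ← h]
        rfl
      rw [map_mul, map_prod, Finset.prod_eq_zero (Finset.mem_Ioo.2 ⟨hJ0, hJ⟩) h1, mul_zero]
    refine ⟨fun J hJ1 hJ ω hω => ArtinSchreier.existsUnique_components (by omega) hJ ω hω,
      fun J hJ1 hJ2 => ?_, fun J hJ1 hJ => ?_⟩
    · have h2 : 2 * J ≤ p + 1 := by
        rw [le_div_iff₀ two_pos, mul_comm] at hJ2
        exact_mod_cast hJ2
      exact ArtinSchreier.Phi_surjective_of_det_ne_zero hpd (by omega) (by omega) h2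
        (hdet J (by omega) (by omega))
    · have h2 : p + 1 ≤ 2 * J := by
        rw [div_le_iff₀ two_pos, mul_comm] at hJ1
        exact_mod_cast hJ1
      exact ArtinSchreier.Phi_injective_of_det_ne_zero hpd hJ h2 (hdet J (by omega) hJ)
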